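/- **Setting.** A network $\mathcal G$ consists of a finite set $\mathcal C$ of nodes and a finite set $\mathcal A$ of arrows, equivalence relations "same node-type" on $\mathcal C$ and "same arrow-type" on $\mathcal A$, and head and tail maps $\mathcal H,\mathcal T:\mathcal A\to\mathcal C$. Put $I(c)=\{a\in\mathcal A:\mathcal H(a)=c\}$. An *input isomorphism* from $c$ to $d$ exists only if $c,d$ have the same node-type, and is an arrow-type preserving bijection $\beta:I(c)\to I(d)$; $c,d$ are *input equivalent* if there is one. *State equivalence* is the equivalence relation generated by $c\sim d$ and $\mathcal T(a)\sim\mathcal T(\beta(a))$ for all input isomorphisms $\beta$ from $c$ to $d$ and all $a\in I(c)$. Each node $c$ has a node space $P_c=\mathbb R^{k_c}$, $k_c\ge 1$, with $P_c=P_d$ for state equivalent $c,d$; $P=\prod_c P_c$ carries the norm $\max_c\|x_c\|$ ($\|\cdot\|$ Euclidean). Let $P_{T(c)}=\prod_{a\in I(c)}P_{\mathcal T(a)}$ and $x_{T(c)}=(x_{\mathcal T(a)})_{a\in I(c)}$. A map $f:P\to P$ is *(smooth) admissible* if $f_c(x)=\hat f_c(x_c,x_{T(c)})$ with $C^\infty$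 maps $\hat f_c:P_c\times P_{T(c)}\to P_c$ such that $\hat f_d(u,v)=\hat f_c(u,\beta^*v)$ for every input isomorphism $\beta$ from $c$ to $d$, where $(\beta^*v)_a=v_{\beta(a)}$. Let $\|p\|_1=\sup_{x\in P}\max(\|p(x)\|,\|\mathrm Dp(x)\|)$. **Periodic orbits.** A periodic orbit of $\dot x=f(x)$ with period $T>0$ is a nonconstant solution with $x(t+T)\equiv x(t)$. It is *hyperbolic* if exactly one Floquet multiplier, counted with algebraic multiplicity, lies on the unit circle (namely $1$). If $x$ is a hyperbolic periodic orbit of the admissible ODE $\dot x=f(x)$ then for all admissible $p$ with $\|p\|_1$ small, $\dot x=f(x)+p(x)$ has a locally unique periodic orbit $\tilde x$ near $x$, with period $\tilde T$ near $T$; its initial condition is fixed by a Poincaré section through a point $x(t_0)$. A property of $(x,T)$ is *rigid* if $(\tilde x,\tilde T)$ has it for all admissible $p$ with $\|p\|_1$ sufficiently small. **Strong hyperbolicity.** A colouring $\bowtie$ is an equivalence relation on $\mathcal C$ relating only state equivalent nodes. For a set $\mathcal R$ of representatives of its classes, let $[c]\in\mathcal R$ be the representative of $c$; the induced ODE on $P^{\mathcal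 R}=\prod_{r\in\mathcal R}P_r$ is $\dot x_r=f_r(x_r,x_{[T(r)]})$, $r\in\mathcal R$, and $x^{\mathcal R}=(x_r)_{r\in\mathcal R}$. The orbit $x$ is *strongly hyperbolic* if it is hyperbolic and, for every colouring $\bowtie$ such that the property "$x_c\equiv x_d$ whenever $c\bowtie d$" is rigid, there is an $\mathcal R$ such that for arbitrarily small admissible $p$ (possibly $p=0$), the orbit $\tilde x^{\mathcal R}$ is a hyperbolic periodic orbit of the induced ODE of $f+p$. **Locally rigid phase shift.** Nodes $c,d$ are related by a locally rigid phase shift $\theta\in\mathbb R$ (a proportion of the period) if $P_c=P_d$ and there is a nonempty open interval $J$ such that, with the section taken at some $t_0\in J$, for all admissible $p$ with $\|p\|_1$ sufficiently small (including $p=0$), $$\tilde x_c(t)=\tilde x_d(t+\theta\tilde T)\qquad\text{for all } t\in J.$$ **Claim.** Let $x$ be a strongly hyperbolic periodic orbit of a $\mathcal G$-admissible ODE $\dot x=f(x)$. If nodes $c,d$ are related by a locally rigid phase shift of $x$, then $c$ and $d$ are input equivalent. -/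

import Mathlib

open scoped ContDiff ENNReal

noncomputable section

/-! ## Periodic orbits and hyperbolicity -/

section Orbits

variable {E : Type*} [NormedAddCommGroup E] [NormedSpace ℝ E]

/-- `x` is a periodic solution of `ẋ = g(x)`, and `T > 0` is a period of it (not necessarily the
minimal one). It is not constant, so equilibria are excluded. -/
structure IsPeriodicOrbit (g : E → E) (x : ℝ → E) (T : ℝ) : Prop where
  period_pos : 0 < T
  solution : ∀ t, HasDerivAt x (g (x t)) t
  periodic : ∀ t, x (t + T) = x t
  nonconstant : ∃ s t, x s ≠ x t

/-- `Y` is the fundamental solution, normalised by `Y 0 = id`, of the variational equation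
`Ẏ = Dg(x(t)) Y` along `x`. -/
structure IsFundamentalSolution (g : E → E) (x : ℝ → E) (Y : ℝ → E →L[ℝ] E) : Prop where
  initial : Y 0 = ContinuousLinearMap.id ℝ E
  solution : ∀ t, HasDerivAt Y ((fderiv ℝ g (x t)).comp (Y t)) t

/-- A hyperbolic periodic orbit: among the Floquet multipliers (the complex eigenvalues, with
algebraic multiplicity, of the monodromy operator `Y T`) exactly one lies on the unit circle;
it is `1` and it is simple. -/
def IsHyperbolicPeriodicOrbit [FiniteDimensional ℝ E] (g : E → E) (x : ℝ → E) (T : ℝ) : Prop :=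
  IsPeriodicOrbit g x T ∧
    ∃ Y : ℝ → E →L[ℝ] E, IsFundamentalSolution g x Y ∧
      (Y T : E →ₗ[ℝ] E).charpoly.rootMultiplicity 1 = 1 ∧
      ∀ μ : ℂ, ((Y T : E →ₗ[ℝ] E).charpoly.map (algebraMap ℝ ℂ)).IsRoot μ → ‖μ‖ = 1 → μ = 1

/-- `x'` is a periodic orbit of `g'` whose period `T'` is within `η` of `T`, and which is
uniformly within `η` of `x` over the time window `[t₀, t₀ + T]`. When `x` is a hyperbolic
`T`-periodic orbit of `g`, `g'` is `C¹`-close to `g` and `η` is small, such an orbit exists and is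
unique up to a small time shift: it is the perturbed periodic orbit. -/
structure IsPerturbedOrbit (x : ℝ → E) (T t₀ η : ℝ) (g' : E → E) (x' : ℝ → E) (T' : ℝ) :
    Prop where
  orbit : IsPeriodicOrbit g' x' T'
  period_near : |T' - T| < η
  near : ∀ t ∈ Set.Icc t₀ (t₀ + T), ‖x' t - x t‖ < η

/-- The `C¹` norm `sup_x max(‖p(x)‖, ‖Dp(x)‖)`, with value `∞` if `p` is not `C¹`-bounded. -/
def c1Norm (p : E → E) : ℝ≥0∞ :=
  ⨆ x, max ‖p x‖ₑ ‖fderiv ℝ p x‖ₑ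

end Orbits

/-! ## Networks -/

/-- A network with nodes `C` and arrows `A`: node-types and arrow-types are given by the
relations "same type". -/
structure Network (C A : Type*) where
  nodeType : Setoid C
  arrowType : Setoid A
  head : A → C
  tail : A → C

namespace Network

variable {C A : Type*} (G : Network C A)

/-- The input set `I(c)`: all arrows with head `c`. -/
abbrev InputSet (c : C) : Type _ := {a : A // G.head a = c}

/-- An input isomorphism from `c` to `d`: the nodes have the same type, and there is an
arrow-type preserving bijection `I(c) → I(d)`. -/
structure InputIso (c d : C) where
  node : G.nodeType c d
  map : G.InputSet c ≃ G.InputSet d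
  arrow : ∀ a : G.InputSet c, G.arrowType a (map a)

/-- Input equivalence `c ∼_I d`. -/
def InputEquivalent (c d : C) : Prop := Nonempty (G.InputIso c d)

/-- State equivalence `c ∼_S d`: the equivalence relation generated by `c ∼ d` and
`T(a) ∼ T(β(a))`, for all input isomorphisms `β` from `c` to `d` and all `a ∈ I(c)`. -/
inductive StateEquivalent : C → C → Prop
  | head {c d : C} (β : G.InputIso c d) : StateEquivalent c d
  | tail {c d : C} (β : G.InputIso c d) (a : G.InputSet c) :
      StateEquivalent (G.tail a) (G.tail (β.map a))
  | refl (c : C) : StateEquivalent c c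
  | symm {c d : C} : StateEquivalent c d → StateEquivalent d c
  | trans {c d e : C} : StateEquivalent c d → StateEquivalent d e → StateEquivalent c e

/-- Node spaces `P_c = ℝ^{k_c}` with `k_c ≥ 1`; state equivalent nodes have the same space. -/
structure NodeSpaces where
  dim : C → ℕ
  dim_pos : ∀ c, 0 < dim c
  dim_eq : ∀ {c d}, G.StateEquivalent c d → dim c = dim d

end Network

/-- The identification of `ℝ^m` with `ℝ^n` for `m = n`. -/
def dimCast {m n : ℕ} (h : m = n) : EuclideanSpace ℝ (Fin m) ≃ₗᵢ[ℝ] EuclideanSpace ℝ (Fin n) :=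
  LinearIsometryEquiv.piLpCongrLeft 2 ℝ ℝ (finCongr h)

/-- Two node states are equal: they lie in the same space, and are the same point of it. -/
def SameState {m n : ℕ} (u : EuclideanSpace ℝ (Fin m)) (v : EuclideanSpace ℝ (Fin n)) : Prop :=
  ∃ h : m = n, dimCast h u = v

namespace Network

variable {C A : Type*} {G : Network C A} (S : G.NodeSpaces)

/-- The node space `P_c`, with the Euclidean norm. -/
abbrev NodeSpaces.Node (c : C) : Type := EuclideanSpace ℝ (Fin (S.dim c))

/-- The state space `P = ∏_c P_c`. Its norm is the maximum of the Euclidean norms of the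
components. -/
abbrev NodeSpaces.State : Type _ := ∀ c : C, S.Node c

/-- The space `P_{T(c)}` of tuples of states of the tail nodes of the input arrows of `c`. -/
abbrev NodeSpaces.Tails (c : C) : Type _ := ∀ a : G.InputSet c, S.Node (G.tail a)

/-- The pullback `β^* : P_{T(d)} → P_{T(c)}` of an input isomorphism `β` from `c` to `d`. -/
def NodeSpaces.pullback {c d : C} (β : G.InputIso c d) (v : S.Tails d) : S.Tails c :=
  fun a => dimCast (S.dim_eq (.tail β a)).symm (v (β.map a))

/-- Smooth `G`-admissible maps `f : P → P`: each component `f_c` is a smooth function `φ_c` of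
`x_c` and `x_{T(c)}`, and `φ_d(u, v) = φ_c(u, β^* v)` for every input isomorphism `β` from `c`
to `d` (with `P_c` and `P_d` identified). -/
def NodeSpaces.IsAdmissible [Fintype C] [DecidableEq C] [Fintype A]
    (f : S.State → S.State) : Prop :=
  ∃ φ : ∀ c, S.Node c × S.Tails c → S.Node c,
    (∀ c, ContDiff ℝ ∞ (φ c)) ∧
    (∀ x c, f x c = φ c (x c, fun a => x (G.tail a))) ∧
    ∀ (c d : C) (β : G.InputIso c d) (u : S.Node d) (v : S.Tails d),
      φ d (u, v) = dimCast (S.dim_eq (.head β))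
        (φ c (dimCast (S.dim_eq (.head β)).symm u, S.pullback β v))

/-! ## Colourings and induced equations -/

variable (G) in
/-- A colouring: an equivalence relation on the nodes, relating only state equivalent nodes. -/
structure Colouring where
  rel : Setoid C
  state : ∀ {c d}, rel c d → G.StateEquivalent c d

/-- A set `R` of representatives for a colouring: one node of each colour. -/
structure Representatives (κ : G.Colouring) where
  nodes : Finset C
  existsUnique : ∀ c, ∃! r, r ∈ nodes ∧ κ.rel r c

/-- `[c]`: the representative with the same colour as `c`. -/
def Representatives.bracket {κ : G.Colouring} (R : Representatives κ) (c : C) : R.nodes :=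
  ⟨(R.existsUnique c).choose, (R.existsUnique c).choose_spec.1.1⟩

theorem Representatives.bracket_rel {κ : G.Colouring} (R : Representatives κ) (c : C) :
    κ.rel (R.bracket c) c :=
  (R.existsUnique c).choose_spec.1.2

/-- The state space `P^R = ∏_{r ∈ R} P_r`. -/
abbrev NodeSpaces.RepState {κ : G.Colouring} (R : Representatives κ) : Type _ :=
  ∀ r : R.nodes, S.Node (r : C)

/-- The point of `P` with components `u_{[c]}`. -/
def NodeSpaces.spread {κ : G.Colouring} (R : Representatives κ) (u : S.RepState R) : S.State :=
  fun c => dimCast (S.dim_eq (κ.state (R.bracket_rel c))) (u (R.bracket c))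

/-- The vector field `f^R` on `P^R` of the induced equation
`ẋ_r = f_r(x_r, x_{[T(r)]})`, `r ∈ R`. -/
def NodeSpaces.induced {κ : G.Colouring} (R : Representatives κ) (f : S.State → S.State) :
    S.RepState R → S.RepState R :=
  fun u r => f (S.spread R u) r

/-- The induced orbit `x^R(t) = (x_r(t))_{r ∈ R}`. -/
def NodeSpaces.inducedOrbit {κ : G.Colouring} (R : Representatives κ) (x : ℝ → S.State) :
    ℝ → S.RepState R :=
  fun t r => x t r

variable [Fintype C] [DecidableEq C] [Fintype A]

/-! ## Rigidity, strong hyperbolicity, phase relations -/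

/-- The property `Q` of periodic orbits (relative to their period) is rigid at the `T`-periodic
orbit `x` of `f`: for all admissible perturbations `p` of sufficiently small `C¹` norm, the
perturbed periodic orbit `x'` of `f + p`, with period `T'`, has property `Q`. The initial
condition of `x'` is fixed by a Poincaré section through `x(t₀)`, here the hyperplane
`{z : ℓ z = ℓ (x t₀)}`, which is transverse to the orbit. -/
def NodeSpaces.IsRigid (f : S.State → S.State) (x : ℝ → S.State) (T t₀ : ℝ)
    (Q : (ℝ → S.State) → ℝ → Prop) : Prop :=
  ∃ ℓ : S.State →L[ℝ] ℝ, ℓ (f (x t₀)) ≠ 0 ∧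
    ∃ η > 0, ∃ ε > 0, ∀ p : S.State → S.State, S.IsAdmissible p → c1Norm p < ENNReal.ofReal ε →
      ∀ (x' : ℝ → S.State) (T' : ℝ), IsPerturbedOrbit x T t₀ η (f + p) x' T' →
        ℓ (x' t₀) = ℓ (x t₀) → Q x' T'

/-- The orbit `x` lies in the polydiagonal of `κ`: nodes of the same colour are synchronous. -/
def NodeSpaces.HasSynchrony (κ : G.Colouring) (x : ℝ → S.State) : Prop :=
  ∀ c d, κ.rel c d → ∀ t, SameState (x t c) (x t d)

/-- Strong hyperbolicity for a colouring: the orbit is hyperbolic, and there is a set `R` of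
representatives such that, after an arbitrarily small admissible perturbation (possibly zero), the
induced orbit is a hyperbolic periodic orbit of the induced equation. -/
def NodeSpaces.IsStronglyHyperbolicFor (κ : G.Colouring) (f : S.State → S.State)
    (x : ℝ → S.State) (T : ℝ) : Prop :=
  IsHyperbolicPeriodicOrbit f x T ∧
    ∃ R : Representatives κ, ∀ δ > 0, ∃ p : S.State → S.State,
      S.IsAdmissible p ∧ c1Norm p < ENNReal.ofReal δ ∧
      ∃ (x' : ℝ → S.State) (T' : ℝ), IsPerturbedOrbit x T 0 δ (f + p) x' T' ∧
        IsHyperbolicPeriodicOrbit (S.induced R (f + p)) (S.inducedOrbit R x') T'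

/-- Strong hyperbolicity: the orbit is hyperbolic, and it is strongly hyperbolic for every
colouring that it has rigidly as a synchrony pattern. For other colourings the induced orbit
is not, or does not remain, a solution of the induced equation, and there is no condition. -/
def NodeSpaces.IsStronglyHyperbolic (f : S.State → S.State) (x : ℝ → S.State) (T : ℝ) : Prop :=
  IsHyperbolicPeriodicOrbit f x T ∧
    ∀ κ : G.Colouring, S.IsRigid f x T 0 (fun x' _ => S.HasSynchrony κ x') →
      S.IsStronglyHyperbolicFor κ f x T

/-- Nodes `c`, `d` are related by a locally rigid phase shift `θ` (a proportion of the period): on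
some nonempty open time interval, the relation `x'_c(t) = x'_d(t + θ T')` holds for the perturbed
periodic orbits `x'` (of period `T'`) of all sufficiently small admissible perturbations, the zero
perturbation included. -/
def NodeSpaces.LocallyRigidPhaseShift (f : S.State → S.State) (x : ℝ → S.State) (T : ℝ)
    (c d : C) (θ : ℝ) : Prop :=
  ∃ a b t₀ : ℝ, t₀ ∈ Set.Ioo a b ∧
    S.IsRigid f x T t₀ (fun x' T' =>
      ∀ t ∈ Set.Ioo a b, SameState (x' t c) (x' (t + θ * T') d))

end Network

end

/-! The phase relation is tested against admissible perturbations, through the first-order response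
of the orbit. With time rescaled to period 1, periodic orbits on the section are zeros of the C¹ map
`orbitMap` on a Banach space. At a hyperbolic orbit its derivative is invertible: the multiplier 1
is simple and the section is transverse (`isInvertible_fderiv_orbitMap`). By the implicit function
theorem the orbit and its period move differentiably under a perturbation `q`, and the derivative is
bounded by a constant times the mean of `‖q‖` along the orbit (`exists_response`). The nearby
nondegenerate orbits therefore form a family that is stable under further small perturbations
(`IsResponsive`), and the phase relation holds throughout it.

Suppose `c` and `d` are not input equivalent. Differentiating the phase relation in time equates the
velocities of `c` and, after the delay, of `d`. If one of these nodes moved, its input state would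
sweep out infinitely many points. Among many disjoint bumps there, one has a small mean along the
orbit, hence a small response, yet has size at least 1 at that node at some time. It vanishes at the
other node, so the derivative of the velocity relation is contradictory
(`field_eq_zero_of_relation`). Hence both nodes are at rest on the whole time window, for every
member of the family.

Nodes at rest are excluded by a dimension count. To be moving, and to be in different states, are
open conditions. Where the finite set of those that hold is maximal within the family
(`IsExtremal`), it is locally constant in time and under perturbation. Then the inputs of a resting
node also rest, by another bump argument, so the linearised field `L` restricts to the resting
nodes. The response there is synchronous, meaning equal at nodes in the same state, and every
admissible `q` restricts to an element of `L(Syn)`, where `Syn` is the space of synchronous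
displacements. Conversely, sums of bumps realise `Λ(Syn)` for an invertible diagonal map `Λ`. So
`Λ(Syn) ⊆ L(Syn)`, and equality follows by dimension. Every admissible `q` must thus be synchronous
up to node weights, but a bump at the input state of `d` is nonzero at `d` and zero at `c`, while
`c` and `d` are in the same state (`inputEquivalent_of_sameState`). -/

noncomputable section

set_option linter.unusedSectionVars false

open Set Filter Topology unitInterval

/-! ## Superposition and Volterra operators -/

section Superposition

variable {K E F : Type*} [TopologicalSpace K] [CompactSpace K]
  [NormedAddCommGroup E] [NormedSpace ℝ E] [NormedAddCommGroup F] [NormedSpace ℝ F]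

/-- Pointwise application of a continuous family of operators, as a bounded bilinear map. -/
def pointwiseApply : C(K, E →L[ℝ] F) →L[ℝ] C(K, E) →L[ℝ] C(K, F) :=
  LinearMap.mkContinuous₂
    (LinearMap.mk₂ ℝ (fun (B : C(K, E →L[ℝ] F)) (y : C(K, E)) =>
        (⟨fun k => B k (y k), B.continuous.clm_apply y.continuous⟩ : C(K, F)))
      (fun _ _ _ => by ext; simp) (fun _ _ _ => by ext; simp)
      (fun _ _ _ => by ext; simp) (fun _ _ _ => by ext; simp)) 1 fun B y => by
    rw [one_mul, ContinuousMap.norm_le _ (by positivity)]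
    exact fun k => (B k).le_of_opNorm_le_of_le (B.norm_coe_le_norm k) (y.norm_coe_le_norm k)

@[simp] theorem pointwiseApply_apply (B : C(K, E →L[ℝ] F)) (y : C(K, E)) (k : K) :
    pointwiseApply B y k = B k (y k) := rfl

/-- The range of `y` is compact, so `g'` is uniformly continuous at it: one radius serves all points
`k`, and the mean value inequality on balls is uniform in `k`. -/
theorem hasFDerivAt_superposition {g : C(E, F)} {g' : C(E, E →L[ℝ] F)}
    (h : ∀ x, HasFDerivAt g (g' x) x) (y : C(K, E)) :
    HasFDerivAt (fun y : C(K, E) => g.comp y) (pointwiseApply (g'.comp y)) y := by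
  rw [hasFDerivAt_iff_isLittleO_nhds_zero, Asymptotics.isLittleO_iff]
  intro ε hε
  have hcomp : IsCompact (range y) := isCompact_range y.continuous
  have hu := hcomp.uniformContinuousAt_of_continuousAt g'
    (fun a _ => g'.continuous.continuousAt) (Metric.dist_mem_uniformity hε)
  obtain ⟨δ, hδ, hδ'⟩ := Metric.mem_uniformity_dist.1 hu
  filter_upwards [Metric.ball_mem_nhds (0 : C(K, E)) hδ] with v hv
  rw [mem_ball_zero_iff] at hv
  rw [ContinuousMap.norm_le _ (by positivity)]
  intro k
  have hk : ‖v k‖ < δ := (v.norm_coe_le_norm k).trans_lt hv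
  have key := (convex_ball (y k) δ).norm_image_sub_le_of_norm_hasFDerivWithin_le'
    (f := g) (f' := g') (φ := g' (y k)) (C := ε) (x := y k) (y := y k + v k)
    (fun x _ => (h x).hasFDerivWithinAt)
    (fun x hx => by
      rw [← dist_eq_norm, dist_comm]
      exact (hδ' (by rwa [dist_comm]) (mem_range_self k)).le)
    (Metric.mem_ball_self hδ) (by simpa using hk)
  simp only [add_sub_cancel_left] at key
  exact key.trans (mul_le_mul_of_nonneg_left (v.norm_coe_le_norm k) hε.le)

theorem contDiff_superposition {g : C(E, F)} (hg : ContDiff ℝ 1 g) :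
    ContDiff ℝ 1 (fun y : C(K, E) => g.comp y) := by
  have h := contDiff_one_iff_fderiv.1 hg
  let g' : C(E, E →L[ℝ] F) := ⟨fderiv ℝ g, h.2⟩
  rw [contDiff_one_iff_hasFDerivAt]
  exact ⟨fun y => pointwiseApply (g'.comp y),
    pointwiseApply.continuous.comp (ContinuousMap.continuous_postcomp g'),
    fun y => hasFDerivAt_superposition (g' := g') (fun x => (h.1 x).hasFDerivAt) y⟩

end Superposition

/-! ### Integration of paths and the operator whose zeros are periodic orbits -/

section Volterra

variable {E : Type*} [NormedAddCommGroup E]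

/-- The continuous extension of a path on `[0, 1]` to the real line. -/
def pathExtend (y : C(I, E)) (r : ℝ) : E := y (projIcc 0 1 zero_le_one r)

theorem continuous_pathExtend (y : C(I, E)) : Continuous (pathExtend y) :=
  y.continuous.comp continuous_projIcc

@[simp] theorem pathExtend_coe (y : C(I, E)) (s : I) : pathExtend y s = y s := by
  simp [pathExtend]

theorem norm_pathExtend_le (y : C(I, E)) (r : ℝ) : ‖pathExtend y r‖ ≤ ‖y‖ :=
  y.norm_coe_le_norm _

variable [NormedSpace ℝ E]

/-- Integration from `0`. -/
def volterra : C(I, E) →L[ℝ] C(I, E) :=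
  LinearMap.mkContinuous
    { toFun := fun y => ⟨fun s => ∫ r in (0 : ℝ)..s, pathExtend y r,
        (intervalIntegral.continuous_primitive
          (fun a b => (continuous_pathExtend y).intervalIntegrable a b) 0).comp
          continuous_subtype_val⟩
      map_add' := fun y w => by
        ext s
        exact intervalIntegral.integral_add ((continuous_pathExtend y).intervalIntegrable _ _)
          ((continuous_pathExtend w).intervalIntegrable _ _)
      map_smul' := fun c y => by
        ext s
        exact intervalIntegral.integral_smul c (pathExtend y) } 1 fun y => by
    rw [one_mul, ContinuousMap.norm_le _ (norm_nonneg y)]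
    intro s
    refine (intervalIntegral.norm_integral_le_of_norm_le_const
      (fun r _ => norm_pathExtend_le y r)).trans ?_
    rw [sub_zero, abs_of_nonneg s.2.1]
    exact mul_le_of_le_one_right (norm_nonneg y) s.2.2

theorem volterra_apply (y : C(I, E)) (s : I) :
    volterra y s = ∫ r in (0 : ℝ)..s, pathExtend y r := rfl

/-- The sup norm on the left against an L¹ norm on the right: this is why a perturbation that is
large only briefly has a small effect on the orbit. -/
theorem norm_volterra_le (y : C(I, E)) :
    ‖volterra y‖ ≤ ∫ r in (0 : ℝ)..1, ‖pathExtend y r‖ := by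
  rw [ContinuousMap.norm_le _ (intervalIntegral.integral_nonneg zero_le_one
    fun _ _ => norm_nonneg _)]
  intro s
  refine (intervalIntegral.norm_integral_le_integral_norm s.2.1).trans ?_
  exact intervalIntegral.integral_mono_interval le_rfl s.2.1 s.2.2
    (Eventually.of_forall fun _ => norm_nonneg _)
    ((continuous_pathExtend y).norm.intervalIntegrable _ _)

/-- The embedding of the constant paths. -/
def constPath : E →L[ℝ] C(I, E) :=
  LinearMap.mkContinuous
    { toFun := fun v => ContinuousMap.const I v
      map_add' := fun _ _ => rfl
      map_smul' := fun _ _ => rfl } 1 fun v => by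
    rw [one_mul, ContinuousMap.norm_le _ (norm_nonneg v)]
    exact fun _ => le_rfl

@[simp] theorem constPath_apply (v : E) (s : I) : constPath v s = v := rfl

/-- The operator whose zeros `(y, τ)` are the `1`-periodic solutions of `ẏ = τ g(y)` that start at
the origin of the section `ℓ`. -/
def orbitMap (ℓ : E →L[ℝ] ℝ) (g : C(E, E)) (u : C(I, E) × ℝ) : C(I, E) × ℝ :=
  (u.1 - constPath (u.1 1) - u.2 • volterra (g.comp u.1), ℓ (u.1 0))

theorem contDiff_eval (s : I) : ContDiff ℝ 1 (fun u : C(I, E) × ℝ => u.1 s) := by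
  change ContDiff ℝ 1 ((ContinuousMap.evalCLM ℝ s : C(I, E) →L[ℝ] E) ∘ Prod.fst)
  exact (ContinuousLinearMap.contDiff _).comp contDiff_fst

theorem contDiff_orbitMap (ℓ : E →L[ℝ] ℝ) {g : C(E, E)} (hg : ContDiff ℝ 1 g) :
    ContDiff ℝ 1 (orbitMap ℓ g) := by
  have h1 : ContDiff ℝ 1 (fun u : C(I, E) × ℝ => constPath (u.1 1)) :=
    (constPath (E := E)).contDiff.comp (contDiff_eval 1)
  have h2 : ContDiff ℝ 1 (fun u : C(I, E) × ℝ => volterra (g.comp u.1)) :=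
    (volterra (E := E)).contDiff.comp ((contDiff_superposition hg).comp contDiff_fst)
  have h3 : ContDiff ℝ 1 (fun u : C(I, E) × ℝ => ℓ (u.1 0)) := ℓ.contDiff.comp (contDiff_eval 0)
  exact ((contDiff_fst.sub h1).sub (contDiff_snd.smul h2)).prodMk h3

theorem orbitMap_add_smul (ℓ : E →L[ℝ] ℝ) (g q : C(E, E)) (ε : ℝ) (u : C(I, E) × ℝ) :
    orbitMap ℓ (g + ε • q) u = orbitMap ℓ g u - ε • (u.2 • volterra (q.comp u.1), 0) := by
  have : (g + ε • q).comp u.1 = g.comp u.1 + ε • q.comp u.1 := by ext; rfl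
  ext s <;> simp [orbitMap, this, smul_add, smul_comm ε u.2, sub_sub, add_assoc]

theorem fderiv_orbitMap_apply (ℓ : E →L[ℝ] ℝ) {g : C(E, E)} (hg : ContDiff ℝ 1 g)
    (u v : C(I, E) × ℝ) :
    fderiv ℝ (orbitMap ℓ g) u v =
      (v.1 - constPath (v.1 1) - (u.2 • volterra (pointwiseApply
          ((⟨fderiv ℝ g, (contDiff_one_iff_fderiv.1 hg).2⟩ : C(E, E →L[ℝ] E)).comp u.1) v.1) +
        v.2 • volterra (g.comp u.1)),
        ℓ (v.1 0)) := by
  have h := contDiff_one_iff_fderiv.1 hg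
  let g' : C(E, E →L[ℝ] E) := ⟨fderiv ℝ g, h.2⟩
  have h1 : HasFDerivAt (fun u : C(I, E) × ℝ => volterra (g.comp u.1))
      (volterra ∘L pointwiseApply (g'.comp u.1) ∘L .fst ℝ _ _) u :=
    (volterra (E := E)).hasFDerivAt.comp u ((hasFDerivAt_superposition
      (g' := g') (fun x => (h.1 x).hasFDerivAt) u.1).comp u hasFDerivAt_fst)
  have h2 : ∀ s : I, HasFDerivAt (fun u : C(I, E) × ℝ => u.1 s)
      ((ContinuousMap.evalCLM ℝ s : C(I, E) →L[ℝ] E) ∘L .fst ℝ _ _) u := fun s =>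
    (ContinuousMap.evalCLM ℝ s : C(I, E) →L[ℝ] E).hasFDerivAt.comp u hasFDerivAt_fst
  have h3 : HasFDerivAt (fun u : C(I, E) × ℝ => constPath (u.1 1)) _ u :=
    (constPath (E := E)).hasFDerivAt.comp u (h2 1)
  have h4 : HasFDerivAt (fun u : C(I, E) × ℝ => ℓ (u.1 0)) _ u := ℓ.hasFDerivAt.comp u (h2 0)
  have h5 := ((hasFDerivAt_fst.sub h3).sub (hasFDerivAt_snd.smul h1)).prodMk h4
  have h6 : fderiv ℝ (orbitMap ℓ g) u = _ := h5.fderiv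
  rw [h6]
  rfl

end Volterra

section Orbits

variable {E : Type*} [NormedAddCommGroup E] [NormedSpace ℝ E]

/-! ## Persistence and first-order response of nondegenerate periodic orbits -/

theorem ContinuousLinearMap.IsInvertible.eventually {F G : Type*} [NormedAddCommGroup F]
    [NormedSpace ℝ F] [CompleteSpace F] [NormedAddCommGroup G] [NormedSpace ℝ G]
    {L : F →L[ℝ] G} (hL : L.IsInvertible) : ∀ᶠ L' in 𝓝 L, L'.IsInvertible := by
  obtain ⟨e, rfl⟩ := hL
  filter_upwards [ContinuousLinearEquiv.nhds e] with L' hL'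
  obtain ⟨e', rfl⟩ := hL'
  exact ⟨e', rfl⟩

/-- A zero of the orbit map at which the derivative is invertible moves differentiably under
perturbations of the vector field, and the derivative stays invertible. -/
theorem exists_response [CompleteSpace E] (ℓ : E →L[ℝ] ℝ) {g : C(E, E)} (hg : ContDiff ℝ 1 g)
    {u₀ : C(I, E) × ℝ} (hu : (fderiv ℝ (orbitMap ℓ g) u₀).IsInvertible) :
    ∃ K : ℝ, 0 ≤ K ∧ ∀ q : C(E, E), ContDiff ℝ 1 q →
      ∃ (u : ℝ → C(I, E) × ℝ) (u' : C(I, E) × ℝ), u 0 = u₀ ∧ HasDerivAt u u' 0 ∧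
        ‖u'‖ ≤ K * ∫ r in (0 : ℝ)..1, ‖pathExtend (q.comp u₀.1) r‖ ∧
        ∀ᶠ ε in 𝓝 (0 : ℝ), orbitMap ℓ (g + ε • q) (u ε) = orbitMap ℓ g u₀ ∧
          (fderiv ℝ (orbitMap ℓ (g + ε • q)) (u ε)).IsInvertible := by
  refine ⟨‖(fderiv ℝ (orbitMap ℓ g) u₀).inverse‖ * |u₀.2|, by positivity, fun q hq => ?_⟩
  -- The perturbed orbit map as a function of `ε` and the unknown together. It is affine in `ε`,
  -- hence jointly C¹, and the implicit function theorem applies.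
  let Φ : ℝ × (C(I, E) × ℝ) → C(I, E) × ℝ := fun w =>
    orbitMap ℓ g w.2 - w.1 • (w.2.2 • volterra (q.comp w.2.1), 0)
  have hΦ : ContDiff ℝ 1 Φ := by
    have h2 : ContDiff ℝ 1 (fun u : C(I, E) × ℝ => volterra (q.comp u.1)) :=
      (volterra (E := E)).contDiff.comp ((contDiff_superposition hq).comp contDiff_fst)
    exact ((contDiff_orbitMap ℓ hg).comp contDiff_snd).sub
      (contDiff_fst.smul (((contDiff_snd.smul h2).prodMk contDiff_const).comp contDiff_snd))
  have hsec : ∀ ε : ℝ, (fun u => Φ (ε, u)) = orbitMap ℓ (g + ε • q) := fun ε =>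
    funext fun u => (orbitMap_add_smul ℓ g q ε u).symm
  have hdiff := hΦ.differentiable one_ne_zero
  have hinr : ∀ w : ℝ × (C(I, E) × ℝ),
      fderiv ℝ Φ w ∘L .inr ℝ _ _ = fderiv ℝ (orbitMap ℓ (g + w.1 • q)) w.2 := by
    rintro ⟨ε, u⟩
    have h : HasFDerivAt (fun u => Φ (ε, u)) (fderiv ℝ Φ (ε, u) ∘L .inr ℝ _ _) u :=
      (hdiff (ε, u)).hasFDerivAt.comp u (hasFDerivAt_prodMk_right ε u)
    rw [hsec] at h
    exact h.fderiv.symm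
  have h0 : (g + (0 : ℝ) • q) = g := by simp
  have hinr0 : fderiv ℝ Φ (0, u₀) ∘L .inr ℝ _ _ = fderiv ℝ (orbitMap ℓ g) u₀ := by
    rw [hinr, h0]
  have hinl0 : fderiv ℝ Φ (0, u₀) (1, 0) = -(u₀.2 • volterra (q.comp u₀.1), 0) := by
    have h : HasFDerivAt (fun ε => Φ (ε, u₀)) (fderiv ℝ Φ (0, u₀) ∘L .inl ℝ _ _) 0 :=
      HasFDerivAt.comp (f := fun ε : ℝ => (ε, u₀)) (0 : ℝ) (hdiff (0, u₀)).hasFDerivAt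
        (hasFDerivAt_prodMk_left (0 : ℝ) u₀)
    have h' : HasFDerivAt (fun ε => Φ (ε, u₀)) _ (0 : ℝ) :=
      ((hasFDerivAt_id (𝕜 := ℝ) (0 : ℝ)).smul_const
        ((u₀.2 • volterra (q.comp u₀.1), 0) : C(I, E) × ℝ)).const_sub (orbitMap ℓ g u₀)
    have := DFunLike.congr_fun (h.unique h') (1 : ℝ)
    simpa using this
  have hstrict := hΦ.contDiffAt.hasStrictFDerivAt (x := (0, u₀)) one_ne_zero
  have hinv : (fderiv ℝ Φ (0, u₀) ∘L .inr ℝ _ _).IsInvertible := by rwa [hinr0]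
  have hder := hstrict.hasStrictFDerivAt_implicitFunctionOfProdDomain hinv
  have heq := hstrict.eventually_apply_implicitFunctionOfProdDomain hinv
  have hat := (hstrict.eventually_apply_eq_iff_implicitFunctionOfProdDomain hinv).self_of_nhds.1 rfl
  set ψ := hstrict.implicitFunctionOfProdDomain hinv
  refine ⟨ψ, _, hat, hder.hasFDerivAt.hasDerivAt, ?_, ?_⟩
  · have : (-(fderiv ℝ Φ (0, u₀) ∘L .inr ℝ _ _).inverse ∘L
        (fderiv ℝ Φ (0, u₀) ∘L .inl ℝ _ _)) 1 =
        (fderiv ℝ (orbitMap ℓ g) u₀).inverse (u₀.2 • volterra (q.comp u₀.1), 0) := by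
      rw [hinr0]
      have h1 : (fderiv ℝ Φ (0, u₀) ∘L .inl ℝ ℝ (C(I, E) × ℝ)) 1 =
          -(u₀.2 • volterra (q.comp u₀.1), 0) := hinl0
      rw [_root_.neg_apply, ContinuousLinearMap.comp_apply, h1, ← map_neg, neg_neg]
    rw [this]
    refine ((fderiv ℝ (orbitMap ℓ g) u₀).inverse.le_opNorm _).trans ?_
    rw [mul_assoc]
    refine mul_le_mul_of_nonneg_left ?_ (norm_nonneg _)
    rw [Prod.norm_mk, norm_zero, max_eq_left (norm_nonneg _), norm_smul, Real.norm_eq_abs]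
    exact mul_le_mul_of_nonneg_left (norm_volterra_le _) (abs_nonneg _)
  -- Invertible operators form an open set, and the partial derivative along the branch `ψ` is
  -- continuous in `ε`.
  · have hcont : Tendsto (fun ε : ℝ => fderiv ℝ Φ (ε, ψ ε) ∘L .inr ℝ _ _) (𝓝 0)
        (𝓝 (fderiv ℝ Φ (0, u₀) ∘L .inr ℝ ℝ (C(I, E) × ℝ))) := by
      have h1 : Tendsto (fun ε : ℝ => (ε, ψ ε)) (𝓝 0) (𝓝 (0, u₀)) := by
        have : Tendsto ψ (𝓝 0) (𝓝 u₀) := by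
          have := hder.continuousAt.tendsto
          rwa [hat] at this
        exact tendsto_id.prodMk_nhds this
      have h2 := (hΦ.continuous_fderiv one_ne_zero).continuousAt (x := (0, u₀))
      exact ((ContinuousLinearMap.compL ℝ _ _ _).flip
        (.inr ℝ ℝ (C(I, E) × ℝ))).continuous.continuousAt.tendsto.comp (h2.tendsto.comp h1)
    filter_upwards [heq, hcont.eventually hinv.eventually] with ε h1 h2
    rw [hinr] at h2
    refine ⟨?_, h2⟩
    have h3 := congrFun (hsec ε) (ψ ε)
    rw [← h3, h1]
    simp [Φ]

/-! ## From zeros of the orbit map to periodic solutions -/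

/-- The `1`-periodic extension of a path. -/
def periodicExtend (y : C(I, E)) (s : ℝ) : E := pathExtend y (Int.fract s)

theorem periodicExtend_add_one (y : C(I, E)) (s : ℝ) :
    periodicExtend y (s + 1) = periodicExtend y s := by
  simp [periodicExtend]

theorem norm_periodicExtend_le (y : C(I, E)) (s : ℝ) : ‖periodicExtend y s‖ ≤ ‖y‖ :=
  norm_pathExtend_le _ _

theorem periodicExtend_eqOn (y : C(I, E)) (h : y 0 = y 1) {s : ℝ} (hs : s ∈ Icc (0 : ℝ) 1) :
    periodicExtend y s = pathExtend y s := by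
  rcases hs.2.eq_or_lt with rfl | h1
  · have h0 : pathExtend y 0 = y 0 := by simpa using pathExtend_coe y 0
    have h1 : pathExtend y 1 = y 1 := by simpa using pathExtend_coe y 1
    simp [periodicExtend, h0, h1, h]
  · rw [periodicExtend, Int.fract_eq_self.2 ⟨hs.1, h1⟩]

theorem continuous_periodicExtend (y : C(I, E)) (h : y 0 = y 1) :
    Continuous (periodicExtend y) := by
  refine ContinuousOn.comp_fract'' (continuous_pathExtend y).continuousOn ?_
  rw [← periodicExtend_eqOn y h ⟨le_rfl, zero_le_one⟩,
    ← periodicExtend_eqOn y h ⟨zero_le_one, le_rfl⟩, ← periodicExtend_add_one, zero_add]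

/-- The integral equation at `s = 0` gives `y 0 = y 1`; at `s = 1` it then says that `τ` times the
integral of `g` over a period vanishes. So the integral equation persists for the periodic extension
at all times, and differentiating it avoids any matching of one-sided derivatives at integers. -/
theorem hasDerivAt_periodicExtend [CompleteSpace E] {ℓ : E →L[ℝ] ℝ} {g : C(E, E)}
    {u : C(I, E) × ℝ}
    (hu : (orbitMap ℓ g u).1 = 0) :
    u.1 0 = u.1 1 ∧ ∀ s, HasDerivAt (periodicExtend u.1) (u.2 • g (periodicExtend u.1 s)) s := by
  obtain ⟨y, τ⟩ := u
  have heq : ∀ s : I, y s = y 1 + τ • ∫ r in (0 : ℝ)..s, pathExtend (g.comp y) r := by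
    intro s
    have : y s - y 1 - τ • volterra (g.comp y) s = 0 := DFunLike.congr_fun hu s
    rw [volterra_apply, sub_sub, sub_eq_zero] at this
    exact this
  have h01 : y 0 = y 1 := by simpa using heq 0
  refine ⟨h01, ?_⟩
  have hz := continuous_periodicExtend y h01
  have hgz : Continuous fun r => g (periodicExtend y r) := g.continuous.comp hz
  have hint : ∀ s ∈ Icc (0 : ℝ) 1,
      ∫ r in (0 : ℝ)..s, pathExtend (g.comp y) r = ∫ r in (0 : ℝ)..s, g (periodicExtend y r) := by
    intro s hs
    refine intervalIntegral.integral_congr fun r hr => ?_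
    rw [uIcc_of_le hs.1] at hr
    change g (pathExtend y r) = g (periodicExtend y r)
    rw [periodicExtend_eqOn y h01 ⟨hr.1, hr.2.trans hs.2⟩]
  have hunit : ∀ s ∈ Icc (0 : ℝ) 1,
      periodicExtend y s = y 1 + τ • ∫ r in (0 : ℝ)..s, g (periodicExtend y r) := by
    intro s hs
    rw [periodicExtend_eqOn y h01 hs, ← hint s hs, ← heq ⟨s, hs⟩]
    exact pathExtend_coe y ⟨s, hs⟩
  have hper : Function.Periodic (fun r => g (periodicExtend y r)) 1 := fun r => by
    simp only [periodicExtend_add_one]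
  have hmean : τ • ∫ r in (0 : ℝ)..1, g (periodicExtend y r) = 0 := by
    rw [← hint 1 ⟨zero_le_one, le_rfl⟩]
    simpa using heq 1
  have hall : ∀ s, periodicExtend y s = y 1 + τ • ∫ r in (0 : ℝ)..s, g (periodicExtend y r) := by
    intro s
    have h1 := hunit (Int.fract s) ⟨Int.fract_nonneg s, (Int.fract_lt_one s).le⟩
    have h2 : periodicExtend y (Int.fract s) = periodicExtend y s := by simp [periodicExtend]
    have h3 : ∫ r in (0 : ℝ)..s, g (periodicExtend y r) =
        (∫ r in (0 : ℝ)..Int.fract s, g (periodicExtend y r)) +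
        ⌊s⌋ • ∫ r in (0 : ℝ)..1, g (periodicExtend y r) := by
      have h4 := hper.intervalIntegral_add_zsmul_eq ⌊s⌋ (Int.fract s)
        (fun a b => hgz.intervalIntegrable a b)
      rw [← intervalIntegral.integral_add_adjacent_intervals
        (hgz.intervalIntegrable 0 (Int.fract s)) (hgz.intervalIntegrable (Int.fract s) s)]
      simp only [zsmul_eq_mul, mul_one, Int.fract_add_floor] at h4
      have h5 := hper.intervalIntegral_add_eq (Int.fract s) 0
      simp only [zero_add] at h5
      rw [h4, h5]
    rw [h3, smul_add, smul_comm τ, hmean, smul_zero, add_zero, ← h2, h1]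
  intro s
  have h := ((intervalIntegral.integral_hasDerivAt_right (hgz.intervalIntegrable 0 s)
    (hgz.stronglyMeasurableAtFilter _ _) hgz.continuousAt).const_smul τ).const_add (y 1)
  exact h.congr_of_eventuallyEq (Eventually.of_forall hall)

/-- One period of an orbit, rescaled to the unit interval. -/
def orbitPath (x : ℝ → E) (hx : Continuous x) (t₀ T : ℝ) : C(I, E) :=
  ⟨fun s => x (t₀ + s * T), by fun_prop⟩

theorem periodicExtend_orbitPath {x : ℝ → E} (hx : Continuous x) {t₀ T : ℝ}
    (hper : ∀ t, x (t + T) = x t) (s : ℝ) :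
    periodicExtend (orbitPath x hx t₀ T) s = x (t₀ + s * T) := by
  have h1 : periodicExtend (orbitPath x hx t₀ T) s = x (t₀ + Int.fract s * T) := by
    have := pathExtend_coe (orbitPath x hx t₀ T)
      ⟨Int.fract s, Int.fract_nonneg s, (Int.fract_lt_one s).le⟩
    exact this
  have h2 : Function.Periodic x T := hper
  rw [h1]
  have := h2.int_mul ⌊s⌋ (t₀ + Int.fract s * T)
  rw [← this]
  congr 1
  have := Int.fract_add_floor s
  linear_combination T * this

theorem orbitMap_orbitPath [CompleteSpace E] (ℓ : E →L[ℝ] ℝ) {g : C(E, E)} {x : ℝ → E} {t₀ T : ℝ}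
    (hx : IsPeriodicOrbit g x T) (hc : Continuous x) :
    orbitMap ℓ g (orbitPath x hc t₀ T, T) = (0, ℓ (x t₀)) := by
  refine Prod.ext ?_ (by simp [orbitMap, orbitPath])
  ext s
  have h1 : ∫ r in (0 : ℝ)..s, T • g (x (t₀ + r * T)) = x (t₀ + s * T) - x (t₀ + 0 * T) := by
    refine intervalIntegral.integral_eq_sub_of_hasDerivAt (f := fun r => x (t₀ + r * T))
      (fun r _ => ?_) ?_
    · have : HasDerivAt (fun r => t₀ + r * T) T r := by
        simpa using ((hasDerivAt_id r).mul_const T).const_add t₀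
      exact (hx.solution (t₀ + r * T)).scomp r this
    · have : Continuous fun r : ℝ => T • g (x (t₀ + r * T)) := by fun_prop
      exact this.intervalIntegrable _ _
  have h2 : volterra (g.comp (orbitPath x hc t₀ T)) s =
      ∫ r in (0 : ℝ)..s, g (x (t₀ + r * T)) := by
    rw [volterra_apply]
    refine intervalIntegral.integral_congr fun r hr => ?_
    rw [uIcc_of_le s.2.1] at hr
    exact pathExtend_coe (g.comp (orbitPath x hc t₀ T)) ⟨r, hr.1, hr.2.trans s.2.2⟩
  have h3 : x (t₀ + T) = x t₀ := hx.periodic t₀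
  rw [intervalIntegral.integral_smul] at h1
  simp only [orbitMap, ContinuousMap.sub_apply, ContinuousMap.smul_apply, h2, h1]
  simp [orbitPath, h3]

end Orbits

/-! ## Hyperbolic periodic orbits are nondegenerate -/

section Hyperbolic

variable {E : Type*} [NormedAddCommGroup E] [NormedSpace ℝ E]

/-- If the eigenvalue `1` is algebraically simple with eigenvector `v`, the only solutions of
`c - M c ∈ span v` are the multiples of `v`. -/
theorem exists_smul_eq_of_sub_eq_smul [FiniteDimensional ℝ E] {M : E →ₗ[ℝ] E}
    (hM : M.charpoly.rootMultiplicity 1 = 1) {v : E} (hv : M v = v) (hv0 : v ≠ 0) {c : E} {a : ℝ}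
    (hc : c - M c = a • v) : ∃ b : ℝ, b • v = c := by
  -- Both `v` and `c` lie in the generalised eigenspace of 1, since `M - 1` kills `v` and its square
  -- kills `c`. Algebraic simplicity makes this space a line.
  have hrank := LinearMap.finrank_maxGenEigenspace_eq M 1
  rw [hM] at hrank
  have hmem : ∀ (k : ℕ) (w : E), ((M - (1 : ℝ) • (1 : Module.End ℝ E)) ^ k) w = 0 →
      w ∈ Module.End.maxGenEigenspace M 1 := fun k w h =>
    (Module.End.mem_maxGenEigenspace M 1 w).2 ⟨k, by simpa using h⟩
  have hv1 : v ∈ Module.End.maxGenEigenspace M 1 := hmem 1 v (by simp [hv])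
  have hc1 : c ∈ Module.End.maxGenEigenspace M 1 := by
    refine hmem 2 c ?_
    have h1 : M c = c - a • v := by rw [← hc]; abel
    simp [pow_two, h1, hv]
  obtain ⟨b, hb⟩ := (finrank_eq_one_iff_of_nonzero'
    (⟨v, hv1⟩ : Module.End.maxGenEigenspace M 1) (by simpa [Subtype.ext_iff] using hv0)).1 hrank
    ⟨c, hc1⟩
  exact ⟨b, congrArg Subtype.val hb⟩

variable {g : C(E, E)} {x : ℝ → E} {T : ℝ} {Y : ℝ → E →L[ℝ] E}

theorem IsPeriodicOrbit.continuous (hx : IsPeriodicOrbit g x T) : Continuous x :=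
  continuous_iff_continuousAt.2 fun t => (hx.solution t).continuousAt

theorem IsPeriodicOrbit.exists_fderiv_bound (hg : ContDiff ℝ 1 g) (hx : IsPeriodicOrbit g x T) :
    ∃ K : NNReal, ∀ t, ‖fderiv ℝ g (x t)‖₊ ≤ K := by
  have hc : Continuous fun t => fderiv ℝ g (x t) :=
    (contDiff_one_iff_fderiv.1 hg).2.comp hx.continuous
  have hp : Function.Periodic (fun t => fderiv ℝ g (x t)) T := fun t => by
    simp only [hx.periodic t]
  obtain ⟨K, hK⟩ := (hp.compact_of_continuous hx.period_pos.ne' hc).isBounded.exists_norm_le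
  refine ⟨K.toNNReal, fun t => ?_⟩
  rw [← NNReal.coe_le_coe, coe_nnnorm]
  exact (hK _ (mem_range_self t)).trans (Real.le_coe_toNNReal K)

/-- Solutions of the variational equation along a periodic orbit that agree once are equal. -/
theorem IsPeriodicOrbit.variational_unique (hg : ContDiff ℝ 1 g) (hx : IsPeriodicOrbit g x T)
    {u w : ℝ → E} (hu : ∀ t, HasDerivAt u (fderiv ℝ g (x t) (u t)) t)
    (hw : ∀ t, HasDerivAt w (fderiv ℝ g (x t) (w t)) t) {s : ℝ} (hs : u s = w s) : u = w := by
  obtain ⟨K, hK⟩ := hx.exists_fderiv_bound hg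
  exact ODE_solution_unique_univ (v := fun t z => fderiv ℝ g (x t) z) (s := fun _ => univ)
    (K := K) (fun t => ((fderiv ℝ g (x t)).lipschitz.weaken (hK t)).lipschitzOnWith)
    (fun t => ⟨hu t, mem_univ _⟩) (fun t => ⟨hw t, mem_univ _⟩) hs

theorem IsFundamentalSolution.hasDerivAt_apply (hY : IsFundamentalSolution g x Y) (v : E) (t : ℝ) :
    HasDerivAt (fun t => Y t v) (fderiv ℝ g (x t) (Y t v)) t := by
  simpa using (hY.solution t).clm_apply (hasDerivAt_const t v)

theorem IsFundamentalSolution.isInvertible [FiniteDimensional ℝ E] (hg : ContDiff ℝ 1 g)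
    (hx : IsPeriodicOrbit g x T) (hY : IsFundamentalSolution g x Y) (t : ℝ) :
    (Y t).IsInvertible := by
  have hinj : Function.Injective (Y t : E →ₗ[ℝ] E) := by
    rw [injective_iff_map_eq_zero]
    intro v hv
    have h := hx.variational_unique hg (hY.hasDerivAt_apply v) (w := fun _ => 0)
      (fun s => by simpa using hasDerivAt_const s (0 : E)) (s := t) hv
    simpa [hY.initial] using congrFun h 0
  exact ⟨(LinearEquiv.ofInjectiveEndo _ hinj).toContinuousLinearEquiv, by ext; rfl⟩

/-- The velocity of the orbit solves the variational equation. At `t = T` this exhibits the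
eigenvector of the multiplier 1. -/
theorem IsFundamentalSolution.apply_field (hg : ContDiff ℝ 1 g)
    (hx : IsPeriodicOrbit g x T) (hY : IsFundamentalSolution g x Y) (t : ℝ) :
    Y t (g (x 0)) = g (x t) := by
  refine congrFun (hx.variational_unique hg (hY.hasDerivAt_apply (g (x 0)))
    (w := fun t => g (x t)) (fun s => ?_) (s := 0) (by simp [hY.initial])) t
  exact ((contDiff_one_iff_fderiv.1 hg).1 (x s)).hasFDerivAt.comp_hasDerivAt s (hx.solution s)

theorem IsFundamentalSolution.apply_add_period (hg : ContDiff ℝ 1 g)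
    (hx : IsPeriodicOrbit g x T) (hY : IsFundamentalSolution g x Y) (t : ℝ) (v : E) :
    Y (t + T) v = Y t (Y T v) := by
  refine congrFun (hx.variational_unique hg (u := fun t => Y (t + T) v) (fun s => ?_)
    (hY.hasDerivAt_apply (Y T v)) (s := 0) (by simp [hY.initial])) t
  have h := (hY.hasDerivAt_apply v (s + T)).comp_add_const s T
  rwa [hx.periodic] at h

/-- Variation of constants along a rescaled orbit. -/
theorem IsFundamentalSolution.hasDerivAt_variation (hg : ContDiff ℝ 1 g)
    (hx : IsPeriodicOrbit g x T) (hY : IsFundamentalSolution g x Y) (t₀ : ℝ) (c : E) (μ : ℝ)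
    {H k : ℝ → E} {s : ℝ} (hH : HasDerivAt H (k s) s) :
    HasDerivAt (fun s => Y (t₀ + s * T) (c + (μ * s) • g (x 0) + H s))
      (T • fderiv ℝ g (x (t₀ + s * T)) (Y (t₀ + s * T) (c + (μ * s) • g (x 0) + H s)) +
        μ • g (x (t₀ + s * T)) + Y (t₀ + s * T) (k s)) s := by
  have h1 : HasDerivAt (fun r => t₀ + r * T) T s := by
    simpa using ((hasDerivAt_id s).mul_const T).const_add t₀
  have h2 := (hY.solution (t₀ + s * T)).scomp s h1
  have h3 : HasDerivAt (fun s => c + (μ * s) • g (x 0) + H s) (μ • g (x 0) + k s) s := by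
    have h4 : HasDerivAt (fun r : ℝ => μ * r) μ s := by
      simpa using (hasDerivAt_id s).const_mul μ
    exact ((h4.smul_const (g (x 0))).const_add c).add hH
  refine (h2.clm_apply h3).congr_deriv ?_
  change T • fderiv ℝ g (x (t₀ + s * T)) (Y (t₀ + s * T) (c + (μ * s) • g (x 0) + H s)) +
    Y (t₀ + s * T) (μ • g (x 0) + k s) = _
  rw [map_add (Y (t₀ + s * T)) (μ • g (x 0)), map_smul (Y (t₀ + s * T)), hY.apply_field hg hx]
  exact (add_assoc _ _ _).symm

/-- At a hyperbolic periodic orbit the derivative of the orbit map is invertible. -/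
theorem IsHyperbolicPeriodicOrbit.isInvertible_fderiv_orbitMap [FiniteDimensional ℝ E]
    (hg : ContDiff ℝ 1 g) (hh : IsHyperbolicPeriodicOrbit g x T) (hc : Continuous x) {t₀ : ℝ}
    {ℓ : E →L[ℝ] ℝ} (hℓ : ℓ (g (x t₀)) ≠ 0) :
    (fderiv ℝ (orbitMap ℓ g) (orbitPath x hc t₀ T, T)).IsInvertible := by
  obtain ⟨hx, Y, hY, hmult, -⟩ := hh
  have hTv : Y T (g (x 0)) = g (x 0) := by
    rw [hY.apply_field hg hx, ← hx.periodic 0, zero_add]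
  have hv0 : g (x 0) ≠ 0 := by
    intro h
    rw [← hY.apply_field hg hx, h, map_zero, map_zero] at hℓ
    exact hℓ rfl
  have hend : ∀ v, Y (t₀ + 1 * T) v = Y t₀ (Y T v) := fun v => by
    rw [one_mul, hY.apply_add_period hg hx]
  -- the finite-dimensional boundary value problem
  let Λ : E × ℝ →ₗ[ℝ] E × ℝ := LinearMap.prod
    ((LinearMap.id - (Y T : E →ₗ[ℝ] E)) ∘ₗ LinearMap.fst ℝ E ℝ -
      (LinearMap.snd ℝ E ℝ).smulRight (g (x 0)))
    ((ℓ : E →ₗ[ℝ] ℝ) ∘ₗ (Y t₀ : E →ₗ[ℝ] E) ∘ₗ LinearMap.fst ℝ E ℝ)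
  have hΛ : ∀ c μ, Λ (c, μ) = (c - Y T c - μ • g (x 0), ℓ (Y t₀ c)) := fun _ _ => rfl
  -- Simplicity of the multiplier 1 forces `c` to be a multiple of the velocity, transversality of
  -- the section forces that multiple to be zero, and then `μ = 0`.
  have hΛinj : Function.Injective Λ := by
    rw [injective_iff_map_eq_zero]
    rintro ⟨c, μ⟩ h
    rw [hΛ, Prod.mk_eq_zero, sub_eq_zero] at h
    obtain ⟨b, rfl⟩ := exists_smul_eq_of_sub_eq_smul hmult hTv hv0 h.1
    have h2 := h.2
    rw [map_smul, map_smul, hY.apply_field hg hx, smul_eq_mul, mul_eq_zero] at h2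
    have hb : b = 0 := h2.resolve_right hℓ
    have h1 := h.1
    subst hb
    simp only [zero_smul, map_zero, sub_zero] at h1
    have hμ : μ = 0 := (smul_eq_zero.1 h1.symm).resolve_right hv0
    simp [hμ]
  have hΛsurj : Function.Surjective Λ := LinearMap.injective_iff_surjective.1 hΛinj
  have hDc := (contDiff_one_iff_fderiv.1 hg).2
  set y := orbitPath x hc t₀ T
  let B : C(I, E →L[ℝ] E) := (⟨fderiv ℝ g, hDc⟩ : C(E, E →L[ℝ] E)).comp y
  let f (ξ : C(I, E)) (μ r : ℝ) : E :=
    T • fderiv ℝ g (x (t₀ + r * T)) (pathExtend ξ r) + μ • g (x (t₀ + r * T))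
  have hfc : ∀ ξ μ, Continuous (f ξ μ) := by
    intro ξ μ
    have h1 : Continuous fun r : ℝ => x (t₀ + r * T) := by fun_prop
    exact (((hDc.comp h1).clm_apply (continuous_pathExtend ξ)).const_smul T).add
      ((g.continuous.comp h1).const_smul μ)
  have hint : ∀ (ξ : C(I, E)) (μ : ℝ) (s : I),
      (T • volterra (pointwiseApply B ξ) + μ • volterra (g.comp y)) s =
        ∫ r in (0 : ℝ)..s, f ξ μ r := by
    intro ξ μ s
    rw [← map_smul volterra T, ← map_smul volterra μ, ← map_add, volterra_apply]
    refine intervalIntegral.integral_congr fun r hr => ?_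
    rw [uIcc_of_le s.2.1] at hr
    have h1 := pathExtend_coe (T • pointwiseApply B ξ + μ • g.comp y) ⟨r, hr.1, hr.2.trans s.2.2⟩
    have h2 := pathExtend_coe ξ ⟨r, hr.1, hr.2.trans s.2.2⟩
    simp only at h1 h2
    simp only [h1, f, h2]
    rfl
  have hform : ∀ (ξ : C(I, E)) (μ : ℝ), fderiv ℝ (orbitMap ℓ g) (y, T) (ξ, μ) =
      (ξ - constPath (ξ 1) - (T • volterra (pointwiseApply B ξ) + μ • volterra (g.comp y)),
        ℓ (ξ 0)) := fun ξ μ => fderiv_orbitMap_apply ℓ hg (y, T) (ξ, μ)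
  -- A kernel element solves the inhomogeneous variational equation, so variation of constants
  -- expresses it through `(c, μ)`. The periodicity and section conditions say `Λ (c, μ) = 0`.
  have hinj : Function.Injective (fderiv ℝ (orbitMap ℓ g) (y, T)) := by
    rw [injective_iff_map_eq_zero]
    rintro ⟨ξ, μ⟩ h
    rw [hform, Prod.mk_eq_zero] at h
    have hξ : ∀ s : I, ξ s = ξ 1 + ∫ r in (0 : ℝ)..s, f ξ μ r := fun s => by
      have := DFunLike.congr_fun h.1 s
      rw [ContinuousMap.sub_apply, ContinuousMap.sub_apply, hint, sub_sub] at this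
      exact sub_eq_zero.1 this
    have h01 : ξ 0 = ξ 1 := by simpa using hξ 0
    obtain ⟨c, hcY⟩ : ∃ c, Y t₀ c = ξ 0 := (hY.isInvertible hg hx t₀).surjective _
    obtain ⟨K, hK⟩ := hx.exists_fderiv_bound hg
    have huniq : EqOn (fun s => ξ 1 + ∫ r in (0 : ℝ)..s, f ξ μ r)
        (fun s => Y (t₀ + s * T) (c + (μ * s) • g (x 0) + 0)) (Icc 0 1) := by
      have hd1 : ∀ s, HasDerivAt (fun s => ξ 1 + ∫ r in (0 : ℝ)..s, f ξ μ r) (f ξ μ s) s :=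
        fun s => (intervalIntegral.integral_hasDerivAt_right ((hfc ξ μ).intervalIntegrable 0 s)
          ((hfc ξ μ).stronglyMeasurableAtFilter _ _) (hfc ξ μ).continuousAt).const_add _
      have hd2 := fun s : ℝ => hY.hasDerivAt_variation hg hx t₀ c μ (H := fun _ => 0)
        (k := fun _ => 0) (s := s) (hasDerivAt_const s 0)
      refine ODE_solution_unique (K := Real.nnabs T * K)
        (v := fun s z => T • fderiv ℝ g (x (t₀ + s * T)) z + μ • g (x (t₀ + s * T)))
        (fun s => ?_) (fun s _ => (hd1 s).continuousAt.continuousWithinAt)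
        (fun s hs => ((hd1 s).congr_deriv ?_).hasDerivWithinAt)
        (fun s _ => (hd2 s).continuousAt.continuousWithinAt)
        (fun s hs => ((hd2 s).congr_deriv (by simp)).hasDerivWithinAt) ?_
      · refine LipschitzWith.of_dist_le_mul fun a b => ?_
        rw [dist_add_right, dist_eq_norm, ← smul_sub, ← map_sub, norm_smul, dist_eq_norm,
          NNReal.coe_mul, Real.coe_nnabs, mul_assoc, Real.norm_eq_abs]
        exact mul_le_mul_of_nonneg_left
          (ContinuousLinearMap.le_of_opNorm_le _ (by exact_mod_cast hK _) _) (abs_nonneg _)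
      · have h1 := hξ ⟨s, hs.1, hs.2.le⟩
        have h2 := pathExtend_coe ξ ⟨s, hs.1, hs.2.le⟩
        simp only at h1 h2
        simp only [f, h2, h1]
      · simp [hcY, h01]
    have hend1 : ξ 1 = Y t₀ (Y T (c + μ • g (x 0))) := by
      have h1 : ξ 1 + ∫ r in (0 : ℝ)..1, f ξ μ r = Y (t₀ + 1 * T) (c + (μ * 1) • g (x 0) + 0) :=
        huniq ⟨zero_le_one, le_rfl⟩
      rw [hend, mul_one, add_zero] at h1
      rw [← h1]
      exact hξ 1
    have hcμ : (c, μ) = 0 := by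
      refine hΛinj ?_
      rw [map_zero, hΛ, Prod.mk_eq_zero, hcY]
      refine ⟨?_, h.2⟩
      rw [← h01, ← hcY] at hend1
      have := (hY.isInvertible hg hx t₀).injective hend1
      rw [map_add, map_smul, hTv] at this
      rw [sub_sub, sub_eq_zero]
      exact this
    rw [Prod.mk_eq_zero] at hcμ
    refine Prod.ext (ContinuousMap.ext fun s => ?_) hcμ.2
    have h1 := huniq s.2
    simp only [hcμ.1, hcμ.2, zero_mul, zero_smul, add_zero, map_zero] at h1
    simp only [hcμ.2] at hξ
    rw [hξ s, h1]
    rfl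
  -- Since `h` is merely continuous, the solution is sought as `ξ = w + h` with `w` differentiable:
  -- `w` solves the variational equation with the extra forcing `T • Dg h`, and the closing
  -- condition `w 0 = w 1 + h 1` is solved with `Λ`.
  have hsurj : Function.Surjective (fderiv ℝ (orbitMap ℓ g) (y, T)) := by
    rintro ⟨h, r⟩
    let k : ℝ → E := fun s =>
      (Y (t₀ + s * T)).inverse (T • fderiv ℝ g (x (t₀ + s * T)) (pathExtend h s))
    have hk : Continuous k := by
      have h1 : Continuous fun s : ℝ => t₀ + s * T := by fun_prop
      have hYc : Continuous Y := continuous_iff_continuousAt.2 fun t => (hY.solution t).continuousAt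
      have h2 : Continuous fun s : ℝ => (Y (t₀ + s * T)).inverse :=
        continuous_iff_continuousAt.2 fun s =>
          ((hY.isInvertible hg hx (t₀ + s * T)).contDiffAt_map_inverse (𝕜 := ℝ)
            (n := 1)).continuousAt.comp (f := fun s : ℝ => Y (t₀ + s * T))
            (hYc.comp h1).continuousAt
      exact h2.clm_apply (((hDc.comp (hc.comp h1)).clm_apply
        (continuous_pathExtend h)).const_smul T)
    let H : ℝ → E := fun s => ∫ r in (0 : ℝ)..s, k r
    have hH : ∀ s, HasDerivAt H (k s) s := fun s =>
      intervalIntegral.integral_hasDerivAt_right (hk.intervalIntegrable 0 s)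
        (hk.stronglyMeasurableAtFilter _ _) hk.continuousAt
    obtain ⟨a, ha⟩ := (hY.isInvertible hg hx t₀).surjective (h 1)
    obtain ⟨⟨c, μ⟩, hcμ⟩ := hΛsurj (Y T (H 1) + a, r - ℓ (h 0))
    rw [hΛ, Prod.mk.injEq] at hcμ
    let w : ℝ → E := fun s => Y (t₀ + s * T) (c + (μ * s) • g (x 0) + H s)
    have hw : ∀ s, HasDerivAt w _ s := fun s => hY.hasDerivAt_variation hg hx t₀ c μ (hH s)
    have hwc : Continuous w := continuous_iff_continuousAt.2 fun s => (hw s).continuousAt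
    let ξ : C(I, E) := ⟨fun s => w s, hwc.comp continuous_subtype_val⟩ + h
    have hw0 : w 0 = Y t₀ c := by simp [w, H]
    have hw1 : w 1 = Y t₀ (Y T c + μ • g (x 0) + Y T (H 1)) := by
      change Y (t₀ + 1 * T) (c + (μ * 1) • g (x 0) + H 1) = _
      rw [hend, mul_one, map_add (Y T), map_add (Y T), map_smul (Y T), hTv]
    have hbd : w 0 = w 1 + h 1 := by
      rw [hw0, hw1, ← ha, ← map_add]
      congr 1
      rw [add_assoc, ← hcμ.1]
      abel
    have hwint : ∀ s : I, w s = w 0 + ∫ r in (0 : ℝ)..s, f ξ μ r := by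
      intro s
      have h1 := intervalIntegral.integral_eq_sub_of_hasDerivAt (a := 0) (b := (s : ℝ)) (f := w)
        (f' := f ξ μ) (fun r hr => (hw r).congr_deriv ?_) ((hfc ξ μ).intervalIntegrable _ _)
      · rw [h1]; abel
      · rw [uIcc_of_le s.2.1] at hr
        have h2 := pathExtend_coe ξ ⟨r, hr.1, hr.2.trans s.2.2⟩
        have h3 := pathExtend_coe h ⟨r, hr.1, hr.2.trans s.2.2⟩
        have h4 : ξ ⟨r, hr.1, hr.2.trans s.2.2⟩ = w r + h ⟨r, hr.1, hr.2.trans s.2.2⟩ := rfl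
        rw [h4, ← h3] at h2
        simp only at h2
        simp only [f, h2, k, (hY.isInvertible hg hx _).self_apply_inverse, map_add, smul_add]
        simp only [w, map_add, smul_add]
        abel
    refine ⟨(ξ, μ), ?_⟩
    rw [hform]
    refine Prod.ext (ContinuousMap.ext fun s => ?_) ?_
    · rw [ContinuousMap.sub_apply, ContinuousMap.sub_apply, hint]
      have h1 : ξ s = w s + h s := rfl
      have h2 : ξ 1 = w 1 + h 1 := rfl
      rw [constPath_apply, h1, h2, ← hbd, hwint s]
      abel
    · have h1 : ξ 0 = w 0 + h 0 := rfl
      change ℓ (ξ 0) = r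
      rw [h1, map_add, hw0, hcμ.2]
      ring
  exact ⟨ContinuousLinearEquiv.ofBijective _ (LinearMap.ker_eq_bot.2 hinj)
    (LinearMap.range_eq_top.2 hsurj), ContinuousLinearEquiv.coe_ofBijective _ _ _⟩

end Hyperbolic

/-! ## Identifications of node spaces -/

@[simp] theorem dimCast_self {n : ℕ} (h : n = n) (u : EuclideanSpace ℝ (Fin n)) :
    dimCast h u = u := by
  ext i
  simp [dimCast]

@[simp] theorem dimCast_dimCast {m n k : ℕ} (h : m = n) (h' : n = k)
    (u : EuclideanSpace ℝ (Fin m)) : dimCast h' (dimCast h u) = dimCast (h.trans h') u := by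
  subst h h'
  simp

/-! ## Maps that are bounded and Lipschitz -/

section Tame

variable {D F : Type*} [NormedAddCommGroup D] [NormedSpace ℝ D]
  [NormedAddCommGroup F] [NormedSpace ℝ F]

/-- Bounded Lipschitz maps. -/
def IsTame (q : D → F) : Prop :=
  ∃ K : ℝ, 0 ≤ K ∧ (∀ x, ‖q x‖ ≤ K) ∧ ∀ x y, ‖q x - q y‖ ≤ K * ‖x - y‖

theorem IsTame.of_hasCompactSupport {q : D → F} (hq : ContDiff ℝ 1 q) (hs : HasCompactSupport q) :
    IsTame q := by
  obtain ⟨K, hK⟩ := hq.lipschitzWith_of_hasCompactSupport hs one_ne_zero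
  obtain ⟨M, hM⟩ := hq.continuous.bounded_above_of_compact_support hs
  refine ⟨max M K, le_max_of_le_right K.2, fun x => (hM x).trans (le_max_left _ _), fun x y => ?_⟩
  have := hK.dist_le_mul x y
  rw [dist_eq_norm, dist_eq_norm] at this
  exact this.trans (mul_le_mul_of_nonneg_right (le_max_right _ _) (norm_nonneg _))

theorem IsTame.comp_clm {D' : Type*} [NormedAddCommGroup D'] [NormedSpace ℝ D'] {q : D → F}
    (hq : IsTame q) (L : D' →L[ℝ] D) : IsTame (fun x => q (L x)) := by
  obtain ⟨K, hK, h1, h2⟩ := hq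
  refine ⟨K * (1 + ‖L‖), by positivity, fun x => (h1 _).trans ?_, fun x y => (h2 _ _).trans ?_⟩
  · nlinarith [norm_nonneg L]
  · rw [← map_sub, mul_assoc]
    refine mul_le_mul_of_nonneg_left ((L.le_opNorm _).trans ?_) hK
    exact mul_le_mul_of_nonneg_right (by linarith) (norm_nonneg _)

theorem IsTame.isometry_comp {F' : Type*} [NormedAddCommGroup F'] [NormedSpace ℝ F'] {q : D → F}
    (hq : IsTame q) (L : F ≃ₗᵢ[ℝ] F') : IsTame (fun x => L (q x)) := by
  obtain ⟨K, hK, h1, h2⟩ := hq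
  exact ⟨K, hK, fun x => by simpa using h1 x, fun x y => by
    rw [← map_sub, L.norm_map]; exact h2 x y⟩

theorem IsTame.sum {ι : Type*} {q : ι → D → F} (s : Finset ι) (hq : ∀ i, IsTame (q i)) :
    IsTame (fun x => ∑ i ∈ s, q i x) := by
  choose K hK h1 h2 using hq
  refine ⟨∑ i ∈ s, K i, Finset.sum_nonneg fun i _ => hK i,
    fun x => norm_sum_le_of_le _ fun i _ => h1 i x, fun x y => ?_⟩
  rw [← Finset.sum_sub_distrib, Finset.sum_mul]
  exact norm_sum_le_of_le _ fun i _ => h2 i x y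

theorem IsTame.pi {ι : Type*} [Fintype ι] {V : ι → Type*} [∀ i, NormedAddCommGroup (V i)]
    [∀ i, NormedSpace ℝ (V i)] {q : D → ∀ i, V i} (hq : ∀ i, IsTame (fun x => q x i)) :
    IsTame q := by
  choose K hK h1 h2 using hq
  have hle : ∀ i, K i ≤ ∑ j, K j := fun i =>
    Finset.single_le_sum (f := K) (fun j _ => hK j) (Finset.mem_univ i)
  have h0 : 0 ≤ ∑ j, K j := Finset.sum_nonneg fun j _ => hK j
  refine ⟨∑ i, K i, h0, fun x => ?_, fun x y => ?_⟩
  · exact (pi_norm_le_iff_of_nonneg h0).2 fun i => (h1 i x).trans (hle i)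
  · refine (pi_norm_le_iff_of_nonneg (by positivity)).2 fun i => (h2 i x y).trans ?_
    exact mul_le_mul_of_nonneg_right (hle i) (norm_nonneg _)

/-- A Lipschitz constant bounds the derivative, so boundedness and the Lipschitz property suffice
for control of the C¹ norm. -/
theorem IsTame.exists_c1Norm_smul_le {q : D → D} (hq : IsTame q) :
    ∃ K : ℝ, 0 ≤ K ∧ ∀ ε : ℝ, c1Norm (ε • q) ≤ ENNReal.ofReal (|ε| * K) := by
  obtain ⟨K, hK, h1, h2⟩ := hq
  refine ⟨K, hK, fun ε => iSup_le fun x => max_le ?_ ?_⟩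
  · rw [← ofReal_norm, Pi.smul_apply, norm_smul]
    exact ENNReal.ofReal_le_ofReal (mul_le_mul_of_nonneg_left (h1 x) (abs_nonneg _))
  · rw [← ofReal_norm]
    refine ENNReal.ofReal_le_ofReal ?_
    have hL : LipschitzWith (Real.toNNReal (|ε| * K)) (ε • q) := by
      refine LipschitzWith.of_dist_le_mul fun a b => ?_
      rw [Real.coe_toNNReal _ (by positivity), dist_eq_norm, dist_eq_norm, Pi.smul_apply,
        Pi.smul_apply, ← smul_sub, norm_smul, mul_assoc]
      exact mul_le_mul_of_nonneg_left (h2 a b) (abs_nonneg _)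
    have := norm_fderiv_le_of_lipschitz ℝ hL (x₀ := x)
    rwa [Real.coe_toNNReal _ (by positivity)] at this

theorem c1Norm_add_le {p q : D → D} (hp : Differentiable ℝ p) (hq : Differentiable ℝ q) :
    c1Norm (p + q) ≤ c1Norm p + c1Norm q := by
  refine iSup_le fun x => ?_
  have h1 : max ‖p x‖ₑ ‖fderiv ℝ p x‖ₑ ≤ c1Norm p :=
    le_iSup (fun x => max ‖p x‖ₑ ‖fderiv ℝ p x‖ₑ) x
  have h2 : max ‖q x‖ₑ ‖fderiv ℝ q x‖ₑ ≤ c1Norm q :=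
    le_iSup (fun x => max ‖q x‖ₑ ‖fderiv ℝ q x‖ₑ) x
  rw [max_le_iff] at h1 h2
  rw [fderiv_add (hp x) (hq x)]
  exact max_le ((enorm_add_le _ _).trans (add_le_add h1.1 h2.1))
    ((enorm_add_le _ _).trans (add_le_add h1.2 h2.2))

end Tame

namespace Network

variable {C A : Type*} {G : Network C A}

/-! ## Input isomorphisms -/

namespace InputIso

theorem ext_map {c d : C} {β γ : G.InputIso c d} (h : β.map = γ.map) : β = γ := by
  cases β
  cases γ
  congr

/-- The identity input isomorphism. -/
def refl (c : C) : G.InputIso c c := ⟨G.nodeType.refl' c, Equiv.refl _, fun _ => G.arrowType.refl' _⟩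

/-- The inverse input isomorphism. -/
def symm {c d : C} (β : G.InputIso c d) : G.InputIso d c :=
  ⟨G.nodeType.symm' β.node, β.map.symm, fun a => by
    have := G.arrowType.symm' (β.arrow (β.map.symm a))
    rwa [Equiv.apply_symm_apply] at this⟩

/-- The composite of two input isomorphisms. -/
def trans {c d e : C} (β : G.InputIso c d) (γ : G.InputIso d e) : G.InputIso c e :=
  ⟨G.nodeType.trans' β.node γ.node, β.map.trans γ.map, fun a =>
    G.arrowType.trans' (β.arrow a) (γ.arrow (β.map a))⟩

/-- Composition with an input isomorphism is bijective. -/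
def transEquiv {d e : C} (c : C) (β : G.InputIso d e) : G.InputIso c d ≃ G.InputIso c e where
  toFun γ := γ.trans β
  invFun γ := γ.trans β.symm
  left_inv _ := ext_map (Equiv.ext fun _ => β.map.symm_apply_apply _)
  right_inv _ := ext_map (Equiv.ext fun _ => β.map.apply_symm_apply _)

instance [Finite A] (c d : C) : Finite (G.InputIso c d) :=
  Finite.of_injective (fun β : G.InputIso c d => β.map) fun _ _ h => ext_map h

instance [Finite A] (c d : C) : Fintype (G.InputIso c d) := Fintype.ofFinite _

end InputIso

variable [Fintype C] [DecidableEq C] [Fintype A] (S : G.NodeSpaces)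

namespace NodeSpaces

/-- The states of a node and of the tails of its input arrows. -/
def inputState (c : C) : S.State →L[ℝ] S.Node c × S.Tails c :=
  (ContinuousLinearMap.proj c).prod
    (ContinuousLinearMap.pi fun a => ContinuousLinearMap.proj (G.tail a))

theorem inputState_apply (c : C) (x : S.State) :
    S.inputState c x = (x c, fun a : G.InputSet c => x (G.tail a)) := rfl

/-- The pullback by an input isomorphism of states of a node and its input tails. -/
def pullPair {c d : C} (β : G.InputIso c d) :
    S.Node d × S.Tails d →L[ℝ] S.Node c × S.Tails c :=
  (((dimCast (S.dim_eq (.head β)).symm).toContinuousLinearEquiv : S.Node d →L[ℝ] S.Node c).comp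
    (ContinuousLinearMap.fst ℝ _ _)).prod
    (ContinuousLinearMap.pi fun a =>
      ((dimCast (S.dim_eq (.tail β a)).symm).toContinuousLinearEquiv :
        S.Node (G.tail (β.map a)) →L[ℝ] S.Node (G.tail a)).comp
        ((ContinuousLinearMap.proj (β.map a)).comp (ContinuousLinearMap.snd ℝ _ _)))

theorem pullPair_apply {c d : C} (β : G.InputIso c d) (w : S.Node d × S.Tails d) :
    S.pullPair β w = (dimCast (S.dim_eq (.head β)).symm w.1, S.pullback β w.2) := rfl

theorem pullPair_refl (c : C) (w : S.Node c × S.Tails c) :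
    S.pullPair (InputIso.refl c) w = w := by
  exact Prod.ext (dimCast_self rfl w.1) (funext fun a => dimCast_self rfl (w.2 a))

theorem pullPair_trans {c d e : C} (β : G.InputIso c d) (γ : G.InputIso d e)
    (w : S.Node e × S.Tails e) :
    S.pullPair (β.trans γ) w = S.pullPair β (S.pullPair γ w) := by
  refine Prod.ext ?_ (funext fun a => ?_)
  · simp [pullPair_apply]
  · simp [pullPair_apply, pullback, InputIso.trans]
    rfl

/-! ## Admissible maps -/

variable {S}

theorem IsAdmissible.contDiff {f : S.State → S.State} (hf : S.IsAdmissible f) :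
    ContDiff ℝ ∞ f := by
  obtain ⟨φ, h1, h2, -⟩ := hf
  refine contDiff_pi.2 fun c => ?_
  have : (fun x => f x c) = φ c ∘ S.inputState c := funext fun x => h2 x c
  rw [this]
  exact (h1 c).comp (S.inputState c).contDiff

theorem IsAdmissible.add {f g : S.State → S.State} (hf : S.IsAdmissible f)
    (hg : S.IsAdmissible g) : S.IsAdmissible (f + g) := by
  obtain ⟨φ, h1, h2, h3⟩ := hf
  obtain ⟨χ, k1, k2, k3⟩ := hg
  refine ⟨fun c w => φ c w + χ c w, fun c => (h1 c).add (k1 c), fun x c => ?_,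
    fun c d β u v => ?_⟩
  · simp [h2, k2]
  · simp [h3 c d β, k3 c d β]

theorem IsAdmissible.smul {f : S.State → S.State} (hf : S.IsAdmissible f) (ε : ℝ) :
    S.IsAdmissible (ε • f) := by
  obtain ⟨φ, h1, h2, h3⟩ := hf
  refine ⟨fun c w => ε • φ c w, fun c => (h1 c).const_smul ε, fun x c => ?_,
    fun c d β u v => ?_⟩
  · simp [h2]
  · simp [h3 c d β]

/-- The derivative of a component of an admissible map only sees the input states. -/
theorem IsAdmissible.fderiv_apply_eq_zero {f : S.State → S.State} (hf : S.IsAdmissible f)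
    {c : C} {v : S.State} (hv : S.inputState c v = 0) (x : S.State) : fderiv ℝ f x v c = 0 := by
  have hd := (hf.contDiff.differentiable (by simp) x).hasFDerivAt
  obtain ⟨φ, h1, h2, -⟩ := hf
  have h3 : HasFDerivAt (fun x => f x c) _ x := (hasFDerivAt_pi'.1 hd) c
  have h4 : HasFDerivAt (φ c ∘ S.inputState c) _ x :=
    ((h1 c).differentiable (by simp) _).hasFDerivAt.comp x (S.inputState c).hasFDerivAt
  have h5 : (fun x => f x c) = φ c ∘ S.inputState c := funext fun x => h2 x c
  rw [h5] at h3
  have := DFunLike.congr_fun (h3.unique h4) v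
  simpa [hv] using this

variable (S) in
/-- The smallest admissible map generated by a function of the input states of the node `e`. -/
def symmetrize (e : C) (ψ : S.Node e × S.Tails e → S.Node e) (x : S.State) : S.State :=
  fun k => ∑ γ : G.InputIso e k,
    dimCast (S.dim_eq (.head γ)) (ψ (S.pullPair γ (S.inputState k x)))

/-- Composition with an input isomorphism from `c` to `d` carries the index set of the sum at `c`
bijectively onto that at `d`. -/
theorem isAdmissible_symmetrize {e : C} {ψ : S.Node e × S.Tails e → S.Node e}
    (hψ : ContDiff ℝ ∞ ψ) : S.IsAdmissible (S.symmetrize e ψ) := by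
  refine ⟨fun k w => ∑ γ : G.InputIso e k, dimCast (S.dim_eq (.head γ)) (ψ (S.pullPair γ w)),
    fun k => ContDiff.sum fun γ _ => ?_, fun x k => rfl, fun c d β u v => ?_⟩
  · exact (LinearIsometryEquiv.contDiff _).comp (hψ.comp (S.pullPair γ).contDiff)
  · have h := Fintype.sum_equiv (InputIso.transEquiv e β)
      (fun γ => dimCast (S.dim_eq (.head (γ.trans β))) (ψ (S.pullPair (γ.trans β) (u, v))))
      (fun γ => dimCast (S.dim_eq (.head γ)) (ψ (S.pullPair γ (u, v)))) (fun γ => rfl)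
    refine h.symm.trans ((Finset.sum_congr rfl fun γ _ => ?_).trans (map_sum _ _ _).symm)
    rw [pullPair_trans, dimCast_dimCast]
    rfl

theorem isTame_symmetrize {e : C} {ψ : S.Node e × S.Tails e → S.Node e}
    (hψ : IsTame ψ) : IsTame (S.symmetrize e ψ) :=
  IsTame.pi fun k => IsTame.sum _ fun γ =>
    ((hψ.comp_clm (S.pullPair γ)).comp_clm (S.inputState k)).isometry_comp _

/-! ## Localised admissible perturbations -/

variable (S) in
/-- A bump function of radius `r` at the input state `w`. -/
def inputBump {e : C} (w : S.Node e × S.Tails e) {r : ℝ} (hr : 0 < r) : ContDiffBump w :=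
  ⟨r / 2, r, by linarith, by linarith⟩

variable (S) in
/-- The admissible vector field `v` near nodes whose input state is isomorphic to `w`. -/
def bumpField {e : C} (w : S.Node e × S.Tails e) {r : ℝ} (hr : 0 < r) (v : S.Node e) :
    S.State → S.State :=
  S.symmetrize e fun w' => S.inputBump w hr w' • v

variable (S) in
/-- The total weight at the node `k` of the bump at the input state `w`. -/
def bumpWeight {e : C} (w : S.Node e × S.Tails e) {r : ℝ} (hr : 0 < r) (k : C) (x : S.State) : ℝ :=
  ∑ γ : G.InputIso e k, S.inputBump w hr (S.pullPair γ (S.inputState k x))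

/-! ### Size and support of bump perturbations -/

section Bump

variable {e : C} (w : S.Node e × S.Tails e) {r : ℝ} (hr : 0 < r) (v : S.Node e)

theorem isAdmissible_bumpField : S.IsAdmissible (S.bumpField w hr v) :=
  isAdmissible_symmetrize ((S.inputBump w hr).contDiff.smul contDiff_const)

theorem isTame_bumpField : IsTame (S.bumpField w hr v) :=
  isTame_symmetrize (IsTame.of_hasCompactSupport
    ((S.inputBump w hr).contDiff.smul contDiff_const)
    (S.inputBump w hr).hasCompactSupport.smul_right)

theorem bumpField_apply {k : C} (h : S.dim e = S.dim k) (x : S.State) :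
    S.bumpField w hr v x k = S.bumpWeight w hr k x • dimCast h v := by
  simp [bumpField, symmetrize, bumpWeight, Finset.sum_smul]

theorem bumpField_apply_of_not {k : C} (h : ¬ G.InputEquivalent e k) (x : S.State) :
    S.bumpField w hr v x k = 0 := by
  have : IsEmpty (G.InputIso e k) := not_nonempty_iff.1 h
  simp [bumpField, symmetrize]

theorem norm_bumpField_apply_le (hv : ‖v‖ ≤ 1) (k : C) (x : S.State) :
    ‖S.bumpField w hr v x k‖ ≤ S.bumpWeight w hr k x := by
  refine norm_sum_le_of_le _ fun γ _ => ?_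
  rw [LinearIsometryEquiv.norm_map, norm_smul,
    Real.norm_of_nonneg (S.inputBump w hr).nonneg]
  exact mul_le_of_le_one_right (S.inputBump w hr).nonneg hv

theorem bumpWeight_nonneg (k : C) (x : S.State) : 0 ≤ S.bumpWeight w hr k x :=
  Finset.sum_nonneg fun _ _ => (S.inputBump w hr).nonneg

/-- The identity input isomorphism already contributes 1, and no other term is negative. -/
theorem one_le_bumpWeight (x : S.State) : 1 ≤ S.bumpWeight (S.inputState e x) hr e x := by
  have h := Finset.single_le_sum (s := Finset.univ)
    (f := fun γ : G.InputIso e e => S.inputBump (S.inputState e x) hr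
      (S.pullPair γ (S.inputState e x)))
    (fun γ _ => (S.inputBump (S.inputState e x) hr).nonneg) (Finset.mem_univ (InputIso.refl e))
  rwa [pullPair_refl, (S.inputBump (S.inputState e x) hr).one_of_mem_closedBall
    (Metric.mem_closedBall_self (S.inputBump (S.inputState e x) hr).rIn_pos.le)] at h

variable (S) in
theorem exists_norm_eq_one (e : C) : ∃ v : S.Node e, ‖v‖ = 1 :=
  ⟨EuclideanSpace.single ⟨0, S.dim_pos e⟩ 1, by simp⟩

end Bump

/-- Bumps with disjoint supports: among many of them one acts only for a short time. -/
theorem exists_bump {z : ℝ → S.State} (hz : Continuous z) {e : C} {J : Set ℝ}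
    (hJ : IsPreconnected J)
    (hne : ((fun t => S.inputState e (z t)) '' J).Nontrivial) {κ : ℝ} (hκ : 0 < κ) :
    ∃ (q : S.State → S.State) (s : ℝ), S.IsAdmissible q ∧ IsTame q ∧ s ∈ J ∧
      (∀ k, ¬ G.InputEquivalent e k → ∀ x, q x k = 0) ∧
      (∫ r in (0 : ℝ)..1, ‖q (z r)‖) ≤ κ ∧ 1 ≤ ‖q (z s) e‖ := by
  have hinf : ((fun t => S.inputState e (z t)) '' J).Infinite :=
    (hJ.image _ ((S.inputState e).continuous.comp hz).continuousOn).infinite_of_nontrivial hne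
  -- A bound for the sum of all bump fields that does not depend on how many there are: each pair of
  -- a node and an input isomorphism sees at most one bump.
  let B : ℝ := ∑ k : C, (Fintype.card (G.InputIso e k) : ℝ)
  obtain ⟨N, hN⟩ := exists_nat_gt (B / κ)
  obtain ⟨t, htJ, htN⟩ := hinf.exists_subset_card_eq (N + 1)
  obtain ⟨r, hr, hsep⟩ : ∃ r : ℝ, 0 < r ∧ ∀ p ∈ t, ∀ p' ∈ t, p ≠ p' → 2 * r < dist p p' := by
    have h : ∀ᶠ r in 𝓝[>] (0 : ℝ), ∀ p ∈ t, ∀ p' ∈ t, p ≠ p' → 2 * r < dist p p' := by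
      simp only [Finset.eventually_all]
      intro p _ p' _
      by_cases hpp : p = p'
      · simp [hpp]
      · have h2 : Tendsto (fun r : ℝ => 2 * r) (𝓝 0) (𝓝 (2 * 0)) := by
          exact (continuous_const.mul continuous_id).tendsto 0
        rw [mul_zero] at h2
        exact (h2.mono_left nhdsWithin_le_nhds).eventually
          ((eventually_lt_nhds (dist_pos.2 hpp)).mono fun _ h _ => h)
    obtain ⟨r, h1, h2⟩ := (h.and self_mem_nhdsWithin).exists
    exact ⟨r, h2, h1⟩
  obtain ⟨v, hv⟩ := S.exists_norm_eq_one e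
  have hdisj : ∀ w : S.Node e × S.Tails e, ∑ p ∈ t, S.inputBump p hr w ≤ 1 := by
    intro w
    by_cases hw : ∃ p ∈ t, dist w p < r
    · obtain ⟨p, hp, hpw⟩ := hw
      rw [Finset.sum_eq_single_of_mem p hp]
      · exact (S.inputBump p hr).le_one
      · intro p' hp' hpp
        refine (S.inputBump p' hr).zero_of_le_dist ?_
        have h1 := hsep p' hp' p hp hpp
        have h2 := dist_triangle_left p' p w
        change r ≤ dist w p'
        linarith
    · push Not at hw
      rw [Finset.sum_eq_zero fun p hp => (S.inputBump p hr).zero_of_le_dist (hw p hp)]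
      exact zero_le_one
  have hsum : ∀ x, ∑ p ∈ t, ‖S.bumpField p hr v x‖ ≤ B := by
    intro x
    calc ∑ p ∈ t, ‖S.bumpField p hr v x‖
        ≤ ∑ p ∈ t, ∑ k, S.bumpWeight p hr k x := by
          refine Finset.sum_le_sum fun p _ => ?_
          refine (pi_norm_le_iff_of_nonneg
            (Finset.sum_nonneg fun k _ => bumpWeight_nonneg p hr k x)).2 fun k => ?_
          exact (norm_bumpField_apply_le p hr v hv.le k x).trans
            (Finset.single_le_sum (f := fun k => S.bumpWeight p hr k x)
              (fun k _ => bumpWeight_nonneg p hr k x) (Finset.mem_univ k))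
      _ = ∑ k, ∑ γ : G.InputIso e k, ∑ p ∈ t,
            S.inputBump p hr (S.pullPair γ (S.inputState k x)) := by
          rw [Finset.sum_comm]
          exact Finset.sum_congr rfl fun k _ => Finset.sum_comm
      _ ≤ ∑ k, ∑ γ : G.InputIso e k, (1 : ℝ) :=
          Finset.sum_le_sum fun k _ => Finset.sum_le_sum fun γ _ => hdisj _
      _ = B := by simp [B]
  have hcont : ∀ p ∈ t, Continuous fun r' => ‖S.bumpField p hr v (z r')‖ := fun p _ =>
    ((isAdmissible_bumpField p hr v).contDiff.continuous.comp hz).norm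
  have hint : ∑ p ∈ t, ∫ r' in (0 : ℝ)..1, ‖S.bumpField p hr v (z r')‖ ≤ ∑ p ∈ t, κ := by
    rw [← intervalIntegral.integral_finsetSum
      fun p hp => (hcont p hp).intervalIntegrable 0 1, Finset.sum_const, htN, nsmul_eq_mul]
    have h1 := intervalIntegral.integral_mono_on (μ := MeasureTheory.volume) (zero_le_one' ℝ)
      ((continuous_finsetSum t hcont).intervalIntegrable 0 1)
      (continuous_const.intervalIntegrable 0 1) (g := fun _ => B) fun r' _ => hsum (z r')
    rw [intervalIntegral.integral_const, sub_zero, one_smul] at h1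
    rw [div_lt_iff₀ hκ] at hN
    push_cast
    linarith
  -- The `N + 1` means add up to at most `B`, and `B < N κ`, so one of them is at most `κ`.
  obtain ⟨p, hp, hpκ⟩ := Finset.exists_le_of_sum_le
    (Finset.card_pos.1 (by rw [htN]; exact Nat.succ_pos N)) hint
  obtain ⟨s, hs, rfl⟩ := htJ hp
  refine ⟨S.bumpField _ hr v, s, isAdmissible_bumpField _ hr v, isTame_bumpField _ hr v, hs,
    fun k hk x => bumpField_apply_of_not _ hr v hk x, hpκ, ?_⟩
  rw [bumpField_apply _ hr v rfl, dimCast_self, norm_smul, hv, mul_one]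
  exact (one_le_bumpWeight hr (z s)).trans (le_abs_self _)

end NodeSpaces

end Network

namespace Network

variable {C A : Type*} {G : Network C A}
variable [Fintype C] [DecidableEq C] [Fintype A] {S : G.NodeSpaces}

namespace NodeSpaces

/-! ## Families of admissible vector fields with responsive solutions -/

/-- `Z ε` is a differentiable family of paths through `Z 0 = z`, with derivative `ξ`, that belong
to the perturbations `g + ε q` within the family `Good`. -/
structure IsResponse (Good : (S.State → S.State) → (ℝ → S.State) → Prop)
    (g : S.State → S.State) (z : ℝ → S.State) (q : S.State → S.State)
    (Z : ℝ → ℝ → S.State) (ξ : ℝ → S.State) : Prop where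
  initial : Z 0 = z
  deriv : ∀ t, HasDerivAt (fun ε => Z ε t) (ξ t) 0
  good : ∀ᶠ ε in 𝓝 (0 : ℝ), Good (g + ε • q) (Z ε)

/-- Families of admissible vector fields `g` with chosen solutions `z`, up to a constant change
of the time scale, which respond differentiably to bounded admissible perturbations `q`, with a
derivative controlled by the mean of `q` along `z`. -/
structure IsResponsive (Good : (S.State → S.State) → (ℝ → S.State) → Prop) : Prop where
  admissible : ∀ {g z}, Good g z → S.IsAdmissible g
  solution : ∀ {g z}, Good g z → ∃ τ : ℝ, τ ≠ 0 ∧ ∀ s, HasDerivAt z (τ • g (z s)) s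
  response : ∀ {g z}, Good g z → ∃ K : ℝ, 0 ≤ K ∧ ∀ q, S.IsAdmissible q → IsTame q →
    ∃ Z ξ, IsResponse Good g z q Z ξ ∧ ∀ t, ‖ξ t‖ ≤ K * ∫ r in (0 : ℝ)..1, ‖q (z r)‖

variable {Good : (S.State → S.State) → (ℝ → S.State) → Prop}
  {g : S.State → S.State} {z : ℝ → S.State} {q : S.State → S.State}
  {Z : ℝ → ℝ → S.State} {ξ : ℝ → S.State}

theorem IsResponsive.continuous (hG : IsResponsive Good) (h : Good g z) : Continuous z := by
  obtain ⟨τ, -, h⟩ := hG.solution h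
  exact continuous_iff_continuousAt.2 fun s => (h s).continuousAt

theorem IsResponse.hasDerivAt_field (hZ : IsResponse Good g z q Z ξ) (hg : S.IsAdmissible g)
    (hq : S.IsAdmissible q) (t : ℝ) :
    HasDerivAt (fun ε => (g + ε • q) (Z ε t)) (fderiv ℝ g (z t) (ξ t) + q (z t)) 0 := by
  have h0 : Z 0 t = z t := by rw [hZ.initial]
  have h1 := (hg.contDiff.differentiable (by simp) (Z 0 t)).hasFDerivAt.comp_hasDerivAt (0 : ℝ)
    (hZ.deriv t)
  have h2 := (hq.contDiff.differentiable (by simp) (Z 0 t)).hasFDerivAt.comp_hasDerivAt (0 : ℝ)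
    (hZ.deriv t)
  have h3 := h1.add ((hasDerivAt_id (0 : ℝ)).smul h2)
  simpa [h0] using! h3

theorem IsResponse.hasDerivAt_field_apply (hZ : IsResponse Good g z q Z ξ)
    (hg : S.IsAdmissible g) (hq : S.IsAdmissible q) (t : ℝ) (k : C) :
    HasDerivAt (fun ε => (g + ε • q) (Z ε t) k) ((fderiv ℝ g (z t) (ξ t)) k + q (z t) k) 0 :=
  hasDerivAt_pi.1 (hZ.hasDerivAt_field hg hq t) k

/-- Where an input state moves, there is a perturbation that is large at some time nearby but has
a small effect on the solution. -/
theorem IsResponsive.exists_bump_response (hG : IsResponsive Good) (hgz : Good g z) {e k : C}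
    (hk : k = e ∨ ∃ a : G.InputSet e, G.tail a = k) {t₀ : ℝ} (hmove : g (z t₀) k ≠ 0)
    {δ κ : ℝ} (hδ : 0 < δ) (hκ : 0 < κ) (R : ℝ) :
    ∃ q Z ξ t, S.IsAdmissible q ∧ IsResponse Good g z q Z ξ ∧ |t - t₀| < δ ∧
      1 ≤ ‖q (z t) e‖ ∧ (∀ j, ¬ G.InputEquivalent e j → ∀ x, q x j = 0) ∧
      ∀ t ∈ Icc (t₀ - R) (t₀ + R), ‖fderiv ℝ g (z t) (ξ t)‖ ≤ κ := by
  have hz := hG.continuous hgz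
  have hg := hG.admissible hgz
  obtain ⟨τ, hτ, hsol⟩ := hG.solution hgz
  have hnt : ((fun t => S.inputState e (z t)) '' Metric.ball t₀ δ).Nontrivial := by
    have hd : HasDerivAt (fun t => z t k) (τ • g (z t₀) k) t₀ := hasDerivAt_pi.1 (hsol t₀) k
    have hev := (hd.eventually_ne (c := z t₀ k) (smul_ne_zero hτ hmove)).and
      (nhdsWithin_le_nhds (Metric.ball_mem_nhds t₀ hδ))
    obtain ⟨t, ht, htb⟩ := hev.exists
    refine ⟨_, mem_image_of_mem _ htb, _, mem_image_of_mem _ (Metric.mem_ball_self hδ), ?_⟩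
    intro h
    simp only [inputState_apply, Prod.mk.injEq] at h
    rcases hk with rfl | ⟨a, rfl⟩
    · exact ht h.1
    · exact ht (congrFun h.2 a)
  obtain ⟨M, hM⟩ := (isCompact_Icc (a := t₀ - R) (b := t₀ + R)).exists_bound_of_continuousOn
    (f := fun t => fderiv ℝ g (z t))
    ((hg.contDiff.continuous_fderiv (by simp)).comp hz).continuousOn
  obtain ⟨K, hK, hresp⟩ := hG.response hgz
  -- The mean is made so small that the factors `K` of the response and `M` of the derivative of `g`
  -- still leave at most `κ`. The summand 1 keeps the denominator positive.
  obtain ⟨q, t, hq, hqt, ht, hq0, hint, h1⟩ := exists_bump hz (convex_ball t₀ δ).isPreconnected hnt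
    (κ := κ / (|M| * K + 1)) (by positivity)
  obtain ⟨Z, ξ, hZ, hξ⟩ := hresp q hq hqt
  refine ⟨q, Z, ξ, t, hq, hZ, by simpa [Real.dist_eq] using ht, h1, hq0, fun t ht => ?_⟩
  have h2 : ‖ξ t‖ ≤ K * (κ / (|M| * K + 1)) :=
    (hξ t).trans (mul_le_mul_of_nonneg_left hint hK)
  calc ‖fderiv ℝ g (z t) (ξ t)‖ ≤ |M| * (K * (κ / (|M| * K + 1))) :=
        ContinuousLinearMap.le_of_opNorm_le_of_le _ ((hM t ht).trans (le_abs_self M)) h2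
    _ = (|M| * K) / (|M| * K + 1) * κ := by ring
    _ ≤ 1 * κ := by
        refine mul_le_mul_of_nonneg_right ?_ hκ.le
        rw [div_le_one (by positivity)]
        linarith
    _ = κ := one_mul κ

/-- If the vector fields at `c` and `d` agree with constant time delays throughout the family, and
`d` is not input equivalent to `c`, then `d` does not move. -/
theorem IsResponsive.field_eq_zero_of_relation (hG : IsResponsive Good) {c d : C}
    (hcd : ¬ G.InputEquivalent d c) (h : S.dim c = S.dim d) {ρ α β : ℝ}
    (hrel : ∀ {g z}, Good g z → ∀ s ∈ Ioo (-ρ) ρ,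
      dimCast h (g (z (s + α)) c) = g (z (s + β)) d)
    (hgz : Good g z) {s : ℝ} (hs : s ∈ Ioo (-ρ) ρ) : g (z (s + β)) d = 0 := by
  by_contra hmove
  obtain ⟨δ, hδ, hδs⟩ := Metric.isOpen_iff.1 isOpen_Ioo s hs
  -- The radius `1 + |α - β|` about `s + β` covers both `t` and the time `t - β + α` at which `c` is
  -- compared with `d` at `t`. Two terms of size at most `1 / 4` cannot balance one of size at least
  -- 1.
  obtain ⟨q, Z, ξ, t, hq, hZ, ht, h1, hq0, hsmall⟩ := hG.exists_bump_response hgz (Or.inl rfl) hmove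
    (lt_min hδ one_pos) (κ := 1 / 4) (by norm_num) (1 + |α - β|)
  have hg := hG.admissible hgz
  obtain ⟨ht1, ht2⟩ := lt_min_iff.1 ht
  have hmem : t - β ∈ Ioo (-ρ) ρ := hδs (by
    rw [Metric.mem_ball, Real.dist_eq, sub_sub, add_comm β]; exact ht1)
  have e1 : t - β + β = t := by ring
  have hd1 := (dimCast h).toContinuousLinearEquiv.hasFDerivAt.comp_hasDerivAt (0 : ℝ)
    (hZ.hasDerivAt_field_apply hg hq (t - β + α) c)
  have hd2 := hZ.hasDerivAt_field_apply hg hq t d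
  have heq : (fun ε => dimCast h ((g + ε • q) (Z ε (t - β + α)) c)) =ᶠ[𝓝 0]
      fun ε => (g + ε • q) (Z ε t) d := by
    filter_upwards [hZ.good] with ε hε
    have := hrel hε _ hmem
    rwa [e1] at this
  have h2 := hd1.unique (hd2.congr_of_eventuallyEq heq)
  have h3 : dimCast h (fderiv ℝ g (z (t - β + α)) (ξ (t - β + α)) c) =
      fderiv ℝ g (z t) (ξ t) d + q (z t) d := by
    rw [hq0 c hcd, add_zero] at h2
    exact h2
  have habs := abs_lt.1 ht2
  have hαβ := abs_le.1 (le_refl |α - β|)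
  have h4 : ‖dimCast h (fderiv ℝ g (z (t - β + α)) (ξ (t - β + α)) c)‖ ≤ 1 / 4 := by
    rw [LinearIsometryEquiv.norm_map]
    exact (norm_le_pi_norm _ c).trans (hsmall _ ⟨by linarith, by linarith⟩)
  have h5 : ‖fderiv ℝ g (z t) (ξ t) d‖ ≤ 1 / 4 :=
    (norm_le_pi_norm _ d).trans (hsmall t ⟨by linarith [abs_nonneg (α - β)],
      by linarith [abs_nonneg (α - β)]⟩)
  have h6 : q (z t) d = dimCast h (fderiv ℝ g (z (t - β + α)) (ξ (t - β + α)) c) -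
      fderiv ℝ g (z t) (ξ t) d := by rw [h3]; abel
  rw [h6] at h1
  linarith [norm_sub_le (dimCast h (fderiv ℝ g (z (t - β + α)) (ξ (t - β + α)) c))
    (fderiv ℝ g (z t) (ξ t) d)]

/-! ## Extremal states -/

/-- The states of a path at a time and after the delay `θ`. -/
def delayPair (θ : ℝ) (z : ℝ → S.State) (s : ℝ) : Bool → S.State := fun b => z (s + cond b θ 0)

/-- Which nodes move, and which pairs of nodes are in different states, at two points of the state
space. -/
def profile (g : S.State → S.State) (P : Bool → S.State) :
    Set ((C × Bool) ⊕ (C × Bool) × (C × Bool)) :=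
  {a | Sum.elim (fun i => g (P i.2) i.1 ≠ 0)
    (fun p => ¬ SameState (P p.1.2 p.1.1) (P p.2.2 p.2.1)) a}

/-- Both kinds of membership are open conditions, and there are finitely many of them. A profile can
only grow in the limit's neighbourhood. -/
theorem eventually_profile_subset {X : Type*} {l : Filter X} {g' : X → S.State → S.State}
    {P' : X → Bool → S.State} {P : Bool → S.State}
    (hP : ∀ b, Tendsto (fun a => P' a b) l (𝓝 (P b)))
    (hg : ∀ b, Tendsto (fun a => g' a (P' a b)) l (𝓝 (g (P b)))) :
    ∀ᶠ a in l, profile g P ⊆ profile (g' a) (P' a) := by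
  have hPk : ∀ (b : Bool) (k : C), Tendsto (fun a => P' a b k) l (𝓝 (P b k)) := fun b k =>
    (tendsto_pi_nhds.1 (hP b)) k
  have h : ∀ p, ∀ᶠ a in l, p ∈ profile g P → p ∈ profile (g' a) (P' a) := by
    rintro (i | ⟨i, j⟩)
    · by_cases hi : g (P i.2) i.1 = 0
      · exact Eventually.of_forall fun a h => absurd hi h
      · exact (((tendsto_pi_nhds.1 (hg i.2)) i.1).eventually_ne hi).mono fun a h _ => h
    · by_cases hij : SameState (P i.2 i.1) (P j.2 j.1)
      · exact Eventually.of_forall fun a h => absurd hij h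
      · by_cases hdim : S.dim i.1 = S.dim j.1
        · have h1 : dimCast hdim (P i.2 i.1) - P j.2 j.1 ≠ 0 :=
            sub_ne_zero.2 fun h => hij ⟨hdim, h⟩
          have h2 := ((((dimCast hdim).continuous.tendsto _).comp (hPk i.2 i.1)).sub
            (hPk j.2 j.1)).eventually_ne h1
          exact h2.mono fun a h _ hs => sub_ne_zero.1 h hs.2
        · exact Eventually.of_forall fun a _ hs => hdim hs.1
  filter_upwards [eventually_all.2 h] with a ha p hp using ha p hp

/-- States with a maximal profile within a family. -/
structure IsExtremal (Good : (S.State → S.State) → (ℝ → S.State) → Prop) (θ ρ : ℝ)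
    (g : S.State → S.State) (z : ℝ → S.State) (s : ℝ) : Prop where
  good : Good g z
  mem : s ∈ Ioo (-ρ) ρ
  maximal : ∀ {g' z' s'}, Good g' z' → s' ∈ Ioo (-ρ) ρ →
    profile g (delayPair θ z s) ⊆ profile g' (delayPair θ z' s') →
    profile g' (delayPair θ z' s') = profile g (delayPair θ z s)

theorem exists_isExtremal (hgz : Good g z) (θ : ℝ) {ρ : ℝ} (hρ : 0 < ρ) :
    ∃ g z s, IsExtremal Good θ ρ g z s := by
  let 𝒮 : Set (Set ((C × Bool) ⊕ (C × Bool) × (C × Bool))) :=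
    {a | ∃ g z s, Good g z ∧ s ∈ Ioo (-ρ) ρ ∧ profile g (delayPair θ z s) = a}
  obtain ⟨a, ⟨g, z, s, h1, h2, rfl⟩, hmax⟩ := (Set.toFinite 𝒮).exists_maximal
    ⟨_, g, z, 0, hgz, ⟨by linarith, hρ⟩, rfl⟩
  exact ⟨g, z, s, h1, h2, fun h1' h2' h => (hmax ⟨_, _, _, h1', h2', rfl⟩ h).antisymm h⟩

variable {θ ρ s : ℝ}

/-- By continuity the profile cannot shrink near `s`, and by maximality it cannot grow. -/
theorem IsExtremal.eventually_time (hG : IsResponsive Good) (h : IsExtremal Good θ ρ g z s) :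
    ∀ᶠ s' in 𝓝 s, IsExtremal Good θ ρ g z s' ∧
      profile g (delayPair θ z s') = profile g (delayPair θ z s) := by
  have hz := hG.continuous h.good
  have hP : ∀ b, Tendsto (fun s' => delayPair θ z s' b) (𝓝 s) (𝓝 (delayPair θ z s b)) := fun b =>
    (hz.comp (continuous_id.add continuous_const)).tendsto s
  have hg := (hG.admissible h.good).contDiff.continuous
  filter_upwards [eventually_profile_subset (g' := fun _ => g) hP
    (fun b => (hg.tendsto _).comp (hP b)), isOpen_Ioo.mem_nhds h.mem] with s' h1 h2
  have h3 := h.maximal h.good h2 h1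
  refine ⟨⟨h.good, h2, fun h1' h2' h' => ?_⟩, h3⟩
  rw [h3] at h' ⊢
  exact h.maximal h1' h2' h'

theorem IsExtremal.eventually_response (hG : IsResponsive Good) (h : IsExtremal Good θ ρ g z s)
    (hq : S.IsAdmissible q) (hZ : IsResponse Good g z q Z ξ) :
    ∀ᶠ ε in 𝓝 (0 : ℝ),
      profile (g + ε • q) (delayPair θ (Z ε) s) = profile g (delayPair θ z s) := by
  have hg := hG.admissible h.good
  have hP : ∀ b, Tendsto (fun ε => delayPair θ (Z ε) s b) (𝓝 (0 : ℝ))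
      (𝓝 (delayPair θ z s b)) := fun b => by
    have := (hZ.deriv (s + cond b θ 0)).continuousAt.tendsto
    rwa [hZ.initial] at this
  have hP2 : ∀ b, Tendsto (fun ε : ℝ => (g + ε • q) (delayPair θ (Z ε) s b)) (𝓝 (0 : ℝ))
      (𝓝 (g (delayPair θ z s b))) := fun b => by
    have := (hZ.hasDerivAt_field hg hq (s + cond b θ 0)).continuousAt.tendsto
    simpa [hZ.initial] using! this
  filter_upwards [eventually_profile_subset (g' := fun ε : ℝ => g + ε • q) hP hP2, hZ.good]
    with ε h1 h2
  exact h.maximal h2 h.mem h1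

/-- At an extremal state, the inputs of a node that does not move do not move. -/
theorem IsExtremal.field_tail_eq_zero (hG : IsResponsive Good) (h : IsExtremal Good θ ρ g z s)
    {e : C} {b : Bool} (he : g (delayPair θ z s b) e = 0) (a : G.InputSet e) :
    g (delayPair θ z s b) (G.tail a) = 0 := by
  by_contra hmove
  obtain ⟨δ, hδ, hev⟩ := Metric.eventually_nhds_iff.1 (h.eventually_time hG)
  -- The bump is placed at the input state of `e`, which moves because the tail does, although `e`
  -- itself rests.
  obtain ⟨q, Z, ξ, t, hq, hZ, ht, h1, -, hsmall⟩ := hG.exists_bump_response h.good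
    (Or.inr ⟨a, rfl⟩) hmove hδ (κ := 1 / 2) (by norm_num) δ
  have hg := hG.admissible h.good
  obtain ⟨h2, h3⟩ := hev (y := t - cond b θ 0) (by
    rw [Real.dist_eq]; convert ht using 2; ring)
  have ht' : t - cond b θ 0 + cond b θ 0 = t := by ring
  -- The profile is frozen under perturbation, so `e` stays at rest and the first-order change of
  -- its velocity is zero, although `q` contributes at least 1 to it.
  have hzero : (fun ε => (g + ε • q) (Z ε t) e) =ᶠ[𝓝 0] fun _ => 0 := by
    filter_upwards [h2.eventually_response hG hq hZ] with ε hε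
    by_contra hne
    have hmem : Sum.inl (e, b) ∈ profile (g + ε • q) (delayPair θ (Z ε) (t - cond b θ 0)) := by
      change (g + ε • q) (Z ε (t - cond b θ 0 + cond b θ 0)) e ≠ 0
      rwa [ht']
    rw [hε, h3] at hmem
    exact hmem he
  have h4 := (hZ.hasDerivAt_field_apply hg hq t e).unique
    ((hasDerivAt_const (0 : ℝ) (0 : S.Node e)).congr_of_eventuallyEq hzero)
  have hta := abs_lt.1 ht
  have h5 : ‖fderiv ℝ g (z t) (ξ t) e‖ ≤ 1 / 2 :=
    (norm_le_pi_norm _ e).trans (hsmall t ⟨by linarith, by linarith⟩)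
  rw [eq_neg_of_add_eq_zero_right h4, norm_neg] at h1
  linarith

end NodeSpaces

end Network

namespace Network

variable {C A : Type*} {G : Network C A}
variable [Fintype C] [DecidableEq C] [Fintype A] {S : G.NodeSpaces}

namespace NodeSpaces

/-! ## Nodes at rest -/

/-- The nodes, at two points of the state space, that do not move. -/
abbrev Resting (g : S.State → S.State) (P : Bool → S.State) : Type _ :=
  {i : C × Bool // g (P i.2) i.1 = 0}

/-- Displacements of the nodes at rest. -/
abbrev RestingState (g : S.State → S.State) (P : Bool → S.State) : Type _ :=
  ∀ i : Resting g P, S.Node i.1.1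

section Resting

variable (g : S.State → S.State) (P : Bool → S.State)

/-- Displacements that agree at nodes in the same state. -/
def synchronous : Submodule ℝ (RestingState g P) where
  carrier := {ζ | ∀ (i j : Resting g P) (h : S.dim i.1.1 = S.dim j.1.1),
    dimCast h (P i.1.2 i.1.1) = P j.1.2 j.1.1 → dimCast h (ζ i) = ζ j}
  add_mem' hζ hη i j h hij := by simp [hζ i j h hij, hη i j h hij]
  zero_mem' i j h hij := by simp
  smul_mem' a ζ hζ i j h hij := by simp [hζ i j h hij]

open Classical in
/-- The displacement of the whole state at one of the two points, zero at moving nodes. -/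
def extendResting (b : Bool) : RestingState g P →ₗ[ℝ] S.State :=
  LinearMap.pi fun k => if h : g (P b) k = 0 then LinearMap.proj (⟨(k, b), h⟩ : Resting g P) else 0

theorem extendResting_apply {b : Bool} {k : C} (h : g (P b) k = 0) (ζ : RestingState g P) :
    extendResting g P b ζ k = ζ ⟨(k, b), h⟩ := by
  simp [extendResting, h]

/-- The linearised vector field at the nodes at rest. -/
def restingDerivative : RestingState g P →ₗ[ℝ] RestingState g P :=
  LinearMap.pi fun i => LinearMap.proj i.1.1 ∘ₗ
    (fderiv ℝ g (P i.1.2) : S.State →ₗ[ℝ] S.State) ∘ₗ extendResting g P i.1.2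

theorem restingDerivative_apply (ζ : RestingState g P) (i : Resting g P) :
    restingDerivative g P ζ i = fderiv ℝ g (P i.1.2) (extendResting g P i.1.2 ζ) i.1.1 := rfl

variable {g P}

/-- Replacing the displacements of moving nodes by zero changes nothing at a resting node: its tails
rest too, and the derivative of an admissible map sees only the node and its tails. -/
theorem restingDerivative_restrict (hg : S.IsAdmissible g)
    (hclosed : ∀ (e : C) (b : Bool), g (P b) e = 0 → ∀ a : G.InputSet e, g (P b) (G.tail a) = 0)
    (ξ : Bool → S.State) (i : Resting g P) :
    restingDerivative g P (fun i => ξ i.1.2 i.1.1) i =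
      fderiv ℝ g (P i.1.2) (ξ i.1.2) i.1.1 := by
  rw [restingDerivative_apply, ← sub_eq_zero, ← Pi.sub_apply, ← map_sub]
  refine hg.fderiv_apply_eq_zero ?_ _
  rw [inputState_apply]
  refine Prod.ext ?_ (funext fun a => ?_)
  · simp [extendResting_apply g P i.2]
  · simp [extendResting_apply g P (hclosed _ _ i.2 a)]

end Resting

variable {Good : (S.State → S.State) → (ℝ → S.State) → Prop}
  {g : S.State → S.State} {z : ℝ → S.State} {q : S.State → S.State} {θ ρ s : ℝ}

/-- At an extremal state, the values of admissible perturbations at the nodes at rest are images of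
synchronous displacements under the linearised vector field. -/
theorem IsExtremal.mem_map_restingDerivative (hG : IsResponsive Good)
    (h : IsExtremal Good θ ρ g z s) (hq : S.IsAdmissible q) (hqt : IsTame q) :
    (fun i => q (delayPair θ z s i.1.2) i.1.1 : RestingState g (delayPair θ z s)) ∈
      (synchronous g (delayPair θ z s)).map (restingDerivative g (delayPair θ z s)) := by
  have hg := hG.admissible h.good
  obtain ⟨K, -, hresp⟩ := hG.response h.good
  obtain ⟨Z, ξ, hZ, -⟩ := hresp q hq hqt
  have hprof := h.eventually_response hG hq hZ
  -- Resting nodes stay at rest, so `Dg ξ + q = 0` at them, and minus the response is a preimage of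
  -- `q`. It is synchronous because nodes in equal states keep equal states along the response.
  refine ⟨-(fun i : Resting g (delayPair θ z s) => delayPair θ ξ s i.1.2 i.1.1), ?_, funext fun i => ?_⟩
  · refine Submodule.neg_mem _ fun i j hdim hij => ?_
    have h1 : ∀ i : Resting g (delayPair θ z s),
        HasDerivAt (fun ε => delayPair θ (Z ε) s i.1.2 i.1.1) (delayPair θ ξ s i.1.2 i.1.1)
        (0 : ℝ) := fun i => hasDerivAt_pi.1 (hZ.deriv _) i.1.1
    have h2 := (dimCast hdim).toContinuousLinearEquiv.hasFDerivAt.comp_hasDerivAt (0 : ℝ) (h1 i)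
    refine h2.unique ((h1 j).congr_of_eventuallyEq ?_)
    filter_upwards [hprof] with ε hε
    by_contra hne
    have hmem : Sum.inr (i.1, j.1) ∈ profile (g + ε • q) (delayPair θ (Z ε) s) := fun hs =>
      hne hs.2
    rw [hε] at hmem
    exact hmem ⟨hdim, hij⟩
  · have hzero : (fun ε => (g + ε • q) (delayPair θ (Z ε) s i.1.2) i.1.1) =ᶠ[𝓝 0] fun _ => 0 := by
      filter_upwards [hprof] with ε hε
      by_contra hne
      have hmem : Sum.inl i.1 ∈ profile (g + ε • q) (delayPair θ (Z ε) s) := hne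
      rw [hε] at hmem
      exact hmem i.2
    have h4 := (hZ.hasDerivAt_field_apply hg hq _ i.1.1).unique
      ((hasDerivAt_const (0 : ℝ) (0 : S.Node i.1.1)).congr_of_eventuallyEq hzero)
    rw [map_neg, Pi.neg_apply, restingDerivative_restrict hg
      fun e b he a => h.field_tail_eq_zero hG he a]
    exact neg_eq_of_add_eq_zero_right h4

/-- At an extremal state, nodes at rest in the same state are input equivalent. -/
theorem IsExtremal.inputEquivalent_of_sameState (hG : IsResponsive Good)
    (h : IsExtremal Good θ ρ g z s) {c d : C × Bool}
    (hc : g (delayPair θ z s c.2) c.1 = 0) (hd : g (delayPair θ z s d.2) d.1 = 0)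
    (hcd : SameState (delayPair θ z s c.2 c.1) (delayPair θ z s d.2 d.1)) :
    G.InputEquivalent d.1 c.1 := by
  classical
  by_contra hne
  set P := delayPair θ z s
  have hmem := fun q hq hqt => h.mem_map_restingDerivative hG (q := q) hq hqt
  let w : ∀ i : Resting g P, S.Node i.1.1 × S.Tails i.1.1 := fun i =>
    S.inputState i.1.1 (P i.1.2)
  -- With `r` this small, a bump centred at `w i` sees the input state of `k` through `γ` only if
  -- `γ` pulls `w k` back to `w i` exactly.
  obtain ⟨r, hr, hsep⟩ : ∃ r : ℝ, 0 < r ∧ ∀ (i k : Resting g P) (γ : G.InputIso i.1.1 k.1.1),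
      S.pullPair γ (w k) ≠ w i → r ≤ dist (S.pullPair γ (w k)) (w i) := by
    have hev : ∀ᶠ r in 𝓝[>] (0 : ℝ), ∀ (i k : Resting g P) (γ : G.InputIso i.1.1 k.1.1),
        S.pullPair γ (w k) ≠ w i → r ≤ dist (S.pullPair γ (w k)) (w i) := by
      simp only [eventually_all]
      intro i k γ hγ
      exact nhdsWithin_le_nhds (eventually_le_nhds (dist_pos.2 hγ))
    obtain ⟨r, h1, h2⟩ := (hev.and self_mem_nhdsWithin).exists
    exact ⟨r, h2, h1⟩
  have hvalue : ∀ ζ ∈ synchronous g P, ∀ i k : Resting g P,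
      S.bumpField (w i) hr (ζ i) (P k.1.2) k.1.1 =
        S.bumpWeight (w i) hr k.1.1 (P k.1.2) • ζ k := by
    intro ζ hζ i k
    rw [bumpWeight, Finset.sum_smul]
    refine Finset.sum_congr rfl fun γ _ => ?_
    rw [map_smul]
    -- In the first case `i` and `k` are in the same state, and synchrony of `ζ` identifies `ζ i`
    -- with `ζ k`; in the second the bump vanishes.
    by_cases hγ : S.pullPair γ (w k) = w i
    · congr 1
      refine hζ i k _ ?_
      have h1 : dimCast (S.dim_eq (.head γ)).symm (P k.1.2 k.1.1) = P i.1.2 i.1.1 :=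
        congrArg Prod.fst hγ
      rw [← h1, dimCast_dimCast, dimCast_self]
    · have h0 : S.inputBump (w i) hr (S.pullPair γ (w k)) = 0 :=
        (S.inputBump (w i) hr).zero_of_le_dist (hsep i k γ hγ)
      change S.inputBump (w i) hr (S.pullPair γ (w k)) • _ =
        S.inputBump (w i) hr (S.pullPair γ (w k)) • _
      rw [h0, zero_smul, zero_smul]
  let n : Resting g P → ℝ := fun k => ∑ i : Resting g P, S.bumpWeight (w i) hr k.1.1 (P k.1.2)
  have hn : ∀ k, n k ≠ 0 := by
    intro k
    have h1 := Finset.single_le_sum (s := Finset.univ)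
      (f := fun i : Resting g P => S.bumpWeight (w i) hr k.1.1 (P k.1.2))
      (fun i _ => bumpWeight_nonneg _ _ _ _) (Finset.mem_univ k)
    have h2 : 1 ≤ S.bumpWeight (w k) hr k.1.1 (P k.1.2) := one_le_bumpWeight hr (P k.1.2)
    have h3 : 1 ≤ n k := h2.trans h1
    linarith
  let Λ : RestingState g P →ₗ[ℝ] RestingState g P :=
    LinearMap.pi fun k => n k • LinearMap.proj k
  have hΛ : ∀ ζ k, Λ ζ k = n k • ζ k := fun _ _ => rfl
  have hΛinj : Function.Injective Λ := by
    intro ζ η hζη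
    funext k
    have := congrFun hζη k
    rw [hΛ, hΛ] at this
    exact smul_right_injective _ (hn k) this
  have hle : (synchronous g P).map Λ ≤ (synchronous g P).map (restingDerivative g P) := by
    rintro _ ⟨ζ, hζ, rfl⟩
    have hadm : ∀ t : Finset (Resting g P),
        S.IsAdmissible (fun x => ∑ i ∈ t, S.bumpField (w i) hr (ζ i) x) := by
      intro t
      induction t using Finset.induction_on with
      | empty =>
        have h0 := (hG.admissible h.good).smul 0
        rw [zero_smul] at h0
        simpa using! h0
      | insert i t hi ih =>
        have h1 := (isAdmissible_bumpField (w i) hr (ζ i)).add ih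
        convert! h1 using 1
        funext x
        rw [Finset.sum_insert hi]
        rfl
    have h1 := hmem _ (hadm Finset.univ)
      (IsTame.sum Finset.univ fun i => isTame_bumpField (w i) hr (ζ i))
    convert! h1 using 1
    funext k
    rw [hΛ, Finset.sum_apply, Finset.sum_smul]
    exact Finset.sum_congr rfl fun i _ => (hvalue ζ hζ i k).symm
  -- `Λ` preserves the dimension of the synchronous space and `restingDerivative` cannot raise it,
  -- so the inclusion is an equality.
  have heq := Submodule.eq_of_le_of_finrank_le hle (by
    rw [← (Submodule.equivMapOfInjective Λ hΛinj _).finrank_eq]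
    exact Submodule.finrank_map_le _ _)
  obtain ⟨v, hv⟩ := S.exists_norm_eq_one d.1
  obtain ⟨ζ, hζ, hζv⟩ : _ ∈ (synchronous g P).map Λ := heq ▸ hmem
    (S.bumpField (w ⟨d, hd⟩) hr v) (isAdmissible_bumpField _ hr v) (isTame_bumpField _ hr v)
  have hζc : ζ ⟨c, hc⟩ = 0 := by
    have h1 := congrFun hζv ⟨c, hc⟩
    rw [hΛ] at h1
    have h2 : S.bumpField (w ⟨d, hd⟩) hr v (P c.2) c.1 = 0 := bumpField_apply_of_not _ hr v hne _
    exact (smul_eq_zero.1 (h1.trans h2)).resolve_left (hn _)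
  have hζd : ζ ⟨d, hd⟩ = 0 := by
    obtain ⟨hdim, h1⟩ := hcd
    have h2 := hζ ⟨c, hc⟩ ⟨d, hd⟩ hdim h1
    rw [hζc, map_zero] at h2
    exact h2.symm
  have h1 := congrFun hζv ⟨d, hd⟩
  rw [hΛ, hζd, smul_zero] at h1
  have h2 : S.bumpField (w ⟨d, hd⟩) hr v (P d.2) d.1 = 0 := h1.symm
  rw [bumpField_apply _ hr v rfl, dimCast_self, smul_eq_zero] at h2
  have h3 : 1 ≤ S.bumpWeight (w ⟨d, hd⟩) hr d.1 (P d.2) := one_le_bumpWeight hr (P d.2)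
  rcases h2 with h2 | h2
  · linarith
  · rw [h2, norm_zero] at hv
    exact zero_ne_one hv

/-- In a responsive family, nodes related by a time delay throughout the family are input
equivalent. -/
theorem IsResponsive.inputEquivalent (hG : IsResponsive Good) (hgz : Good g z) (hρ : 0 < ρ)
    {c d : C}
    (hphase : ∀ {g z}, Good g z → ∀ s ∈ Ioo (-ρ) ρ, SameState (z s c) (z (s + θ) d)) :
    G.InputEquivalent c d := by
  by_contra hcd
  have hdc : ¬ G.InputEquivalent d c := fun ⟨β⟩ => hcd ⟨β.symm⟩
  have hdim : S.dim c = S.dim d := (hphase hgz 0 ⟨by linarith, hρ⟩).1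
  -- Time derivative of the phase relation; the time-scale factor `τ` is the same on both sides and
  -- cancels.
  have hrel : ∀ {g z}, Good g z → ∀ s ∈ Ioo (-ρ) ρ,
      dimCast hdim (g (z (s + 0)) c) = g (z (s + θ)) d := by
    intro g z hgz s hs
    obtain ⟨τ, hτ, hsol⟩ := hG.solution hgz
    have h1 := (dimCast hdim).toContinuousLinearEquiv.hasFDerivAt.comp_hasDerivAt s
      (hasDerivAt_pi.1 (hsol s) c)
    have h2 := (hasDerivAt_pi.1 (hsol (s + θ)) d).comp_add_const s θ
    have h3 := h1.unique (h2.congr_of_eventuallyEq (by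
      filter_upwards [isOpen_Ioo.mem_nhds hs] with s' hs'
      exact (hphase hgz s' hs').2))
    have h4 : dimCast hdim (τ • g (z s) c) = τ • g (z (s + θ)) d := h3
    rw [map_smul] at h4
    rw [add_zero]
    exact smul_right_injective _ hτ h4
  have hrel' : ∀ {g z}, Good g z → ∀ s ∈ Ioo (-ρ) ρ,
      dimCast hdim.symm (g (z (s + θ)) d) = g (z (s + 0)) c := by
    intro g z hgz s hs
    rw [← hrel hgz s hs]
    simp
  obtain ⟨g, z, s, hext⟩ := exists_isExtremal hgz θ hρ
  have h1 := hG.field_eq_zero_of_relation hdc hdim hrel hext.good hext.mem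
  have h2 := hG.field_eq_zero_of_relation hcd hdim.symm hrel' hext.good hext.mem
  refine hdc (hext.inputEquivalent_of_sameState hG (c := (c, false)) (d := (d, true)) h2 h1 ?_)
  have h3 := hphase hext.good s hext.mem
  change SameState (z (s + 0) c) (z (s + θ) d)
  rwa [add_zero]

end NodeSpaces

end Network

/-! ## Perturbed periodic orbits -/

section Perturbed

variable {E : Type*} [NormedAddCommGroup E] [NormedSpace ℝ E]

theorem periodicExtend_sub (y y' : C(I, E)) (s : ℝ) :
    periodicExtend (y - y') s = periodicExtend y s - periodicExtend y' s := rfl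

theorem hasDerivAt_periodicExtend_path {U : ℝ → C(I, E) × ℝ} {u' : C(I, E) × ℝ} {a : ℝ}
    (hU : HasDerivAt U u' a) (s : ℝ) :
    HasDerivAt (fun ε => periodicExtend (U ε).1 s) (periodicExtend u'.1 s) a := by
  let L : C(I, E) × ℝ →L[ℝ] E :=
    (ContinuousMap.evalCLM ℝ (projIcc 0 1 zero_le_one (Int.fract s)) : C(I, E) →L[ℝ] E).comp
      (ContinuousLinearMap.fst ℝ _ _)
  exact L.hasFDerivAt.comp_hasDerivAt a hU

/-- The solution with period `u.2` that passes through the path `u.1`, starting at time `t₀`. -/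
def orbitOf (t₀ : ℝ) (u : C(I, E) × ℝ) (t : ℝ) : E := periodicExtend u.1 ((t - t₀) / u.2)

theorem orbitOf_add_mul {t₀ : ℝ} {u : C(I, E) × ℝ} (hu : u.2 ≠ 0) (s : ℝ) :
    orbitOf t₀ u (t₀ + s * u.2) = periodicExtend u.1 s := by
  rw [orbitOf, add_sub_cancel_left, mul_div_cancel_right₀ _ hu]

/-- Zeros of perturbed orbit maps near a periodic orbit are perturbed orbits. -/
theorem eventually_isPerturbedOrbit [CompleteSpace E] (ℓ : E →L[ℝ] ℝ) {f : E → E} {x : ℝ → E}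
    {T : ℝ} (hx : IsPeriodicOrbit f x T) (hc : Continuous x) (t₀ : ℝ) {η : ℝ} (hη : 0 < η) :
    ∀ᶠ u in 𝓝 (orbitPath x hc t₀ T, T), 0 < u.2 ∧ u.2 < 2 * T ∧
      ∀ g : C(E, E), (orbitMap ℓ g u).1 = 0 →
        IsPerturbedOrbit x T t₀ η g (orbitOf t₀ u) u.2 := by
  have hT := hx.period_pos
  obtain ⟨t₁, t₂, hne⟩ := hx.nonconstant
  have htime : Tendsto (fun u : C(I, E) × ℝ => u.2) (𝓝 (orbitPath x hc t₀ T, T)) (𝓝 T) :=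
    continuous_snd.tendsto _
  have hpath : ∀ δ > 0, ∀ᶠ u in 𝓝 (orbitPath x hc t₀ T, T), ‖u.1 - orbitPath x hc t₀ T‖ < δ := by
    intro δ hδ
    have h : Tendsto (fun u : C(I, E) × ℝ => u.1) (𝓝 (orbitPath x hc t₀ T, T))
      (𝓝 (orbitPath x hc t₀ T)) := continuous_fst.tendsto _
    filter_upwards [h.eventually (Metric.ball_mem_nhds _ hδ)] with u hu
    rwa [← mem_ball_iff_norm]
  -- Uniform cost of reparametrising `x` from period `T` to period `τ`; the other `η / 2` is for the
  -- distance between the paths.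
  have hnear : ∀ᶠ τ in 𝓝 T, ∀ t ∈ Icc t₀ (t₀ + T), ‖x (t₀ + (t - t₀) / τ * T) - x t‖ < η / 2 := by
    refine isCompact_Icc.eventually_forall_of_forall_eventually fun t _ => ?_
    have h : ContinuousAt (fun w : ℝ × ℝ => ‖x (t₀ + (w.2 - t₀) / w.1 * T) - x w.2‖) (T, t) := by
      have h1 : ContinuousAt (fun w : ℝ × ℝ => t₀ + (w.2 - t₀) / w.1 * T) (T, t) :=
        continuousAt_const.add (((continuousAt_snd.sub continuousAt_const).div continuousAt_fst
          hT.ne').mul continuousAt_const)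
      exact ((hc.continuousAt.comp h1).sub (hc.continuousAt.comp continuousAt_snd)).norm
    refine h.eventually (eventually_lt_nhds ?_)
    simp [hT.ne', hη]
  -- Paths within half the distance of two distinct points of the orbit cannot be constant.
  have hsep : 0 < ‖x t₁ - x t₂‖ / 2 := half_pos (norm_pos_iff.2 (sub_ne_zero.2 hne))
  filter_upwards [htime.eventually (lt_mem_nhds hT),
    htime.eventually (gt_mem_nhds (show T < 2 * T by linarith)),
    htime.eventually (Metric.ball_mem_nhds T hη), htime.eventually hnear,
    hpath _ (half_pos hη), hpath _ hsep] with u h1 h2 h3 h4 h5 h6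
  refine ⟨h1, h2, fun g hg => ?_⟩
  have hdist : ∀ s, ‖periodicExtend u.1 s - x (t₀ + s * T)‖ ≤ ‖u.1 - orbitPath x hc t₀ T‖ := by
    intro s
    rw [← periodicExtend_orbitPath hc hx.periodic, ← periodicExtend_sub]
    exact norm_periodicExtend_le _ _
  refine ⟨⟨h1, fun t => ?_, fun t => ?_, ?_⟩, by simpa [Real.dist_eq] using h3, fun t ht => ?_⟩
  · have hd : HasDerivAt (fun t => (t - t₀) / u.2) (1 / u.2) t :=
      ((hasDerivAt_id t).sub_const t₀).div_const u.2
    have := ((hasDerivAt_periodicExtend hg).2 ((t - t₀) / u.2)).scomp t hd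
    rwa [smul_smul, one_div, inv_mul_cancel₀ h1.ne', one_smul] at this
  · have : (t + u.2 - t₀) / u.2 = (t - t₀) / u.2 + 1 := by
      field_simp
      ring
    rw [orbitOf, this, periodicExtend_add_one]
    rfl
  · have ht : ∀ t, t₀ + (t - t₀) / T * T = t := fun t => by
      rw [div_mul_cancel₀ _ hT.ne']; ring
    refine ⟨t₀ + (t₁ - t₀) / T * u.2, t₀ + (t₂ - t₀) / T * u.2, fun heq => ?_⟩
    rw [orbitOf_add_mul h1.ne', orbitOf_add_mul h1.ne'] at heq
    have e1 := hdist ((t₁ - t₀) / T)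
    have e2 := hdist ((t₂ - t₀) / T)
    rw [ht, heq, ← neg_sub, norm_neg] at e1
    rw [ht] at e2
    have e3 := norm_sub_le_norm_sub_add_norm_sub (x t₁) (periodicExtend u.1 ((t₂ - t₀) / T)) (x t₂)
    linarith
  · have e1 := hdist ((t - t₀) / u.2)
    have e2 := norm_sub_le_norm_sub_add_norm_sub (orbitOf t₀ u t)
      (x (t₀ + (t - t₀) / u.2 * T)) (x t)
    have e3 := h4 t ht
    have e4 : ‖orbitOf t₀ u t - x (t₀ + (t - t₀) / u.2 * T)‖ < η / 2 := e1.trans_lt h5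
    linarith

end Perturbed

/-! ### The responsive family of nearby periodic orbits -/

namespace Network

variable {C A : Type*} {G : Network C A}
variable [Fintype C] [DecidableEq C] [Fintype A] {S : G.NodeSpaces}

namespace NodeSpaces

/-- The admissible vector fields near `f` with solutions `z`, rescaled to period `1`, that are
given by nondegenerate zeros of the orbit map in the set `𝒰`. -/
def IsNearbyOrbit (f : S.State → S.State) (ε₀ : ℝ) (ℓ : S.State →L[ℝ] ℝ) (v : ℝ)
    (𝒰 : Set (C(I, S.State) × ℝ)) (g : S.State → S.State) (z : ℝ → S.State) : Prop :=
  ∃ (p : S.State → S.State) (h : C(S.State, S.State)) (u : C(I, S.State) × ℝ),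
    S.IsAdmissible p ∧ c1Norm p < ENNReal.ofReal ε₀ ∧ h = f + p ∧ g = f + p ∧
      z = periodicExtend u.1 ∧ u ∈ 𝒰 ∧ orbitMap ℓ h u = (0, v) ∧
      (fderiv ℝ (orbitMap ℓ h) u).IsInvertible

/-- The constraints of smallness, membership in `𝒰` and nondegeneracy are all open, so the branch
from `exists_response` stays in the family for small `ε`. -/
theorem isResponsive_isNearbyOrbit {f : S.State → S.State} (hf : S.IsAdmissible f) (ε₀ : ℝ)
    (ℓ : S.State →L[ℝ] ℝ) (v : ℝ) {𝒰 : Set (C(I, S.State) × ℝ)} (hopen : IsOpen 𝒰)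
    (hpos : ∀ u ∈ 𝒰, 0 < u.2) : IsResponsive (IsNearbyOrbit f ε₀ ℓ v 𝒰) := by
  refine ⟨?_, ?_, ?_⟩
  · rintro g z ⟨p, h, u, hp, -, -, rfl, -⟩
    exact hf.add hp
  · rintro g z ⟨p, h, u, hp, -, hh, rfl, rfl, hu, hzero, -⟩
    refine ⟨u.2, (hpos u hu).ne', ?_⟩
    rw [← hh]
    exact (hasDerivAt_periodicExtend (congrArg Prod.fst hzero)).2
  · rintro g z ⟨p, h, u, hp, hpε, hh, rfl, rfl, hu, hzero, hinv⟩
    have hfp := hf.add hp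
    have hsm : ContDiff ℝ 1 h := by
      rw [hh]; exact hfp.contDiff.of_le (by exact_mod_cast le_top)
    obtain ⟨K, hK, hresp⟩ := exists_response ℓ hsm hinv
    refine ⟨K, hK, fun q hq hqt => ?_⟩
    let q' : C(S.State, S.State) := ⟨q, hq.contDiff.continuous⟩
    obtain ⟨U, u', hU0, hU, hu', hev⟩ := hresp q' (hq.contDiff.of_le (by exact_mod_cast le_top))
    refine ⟨fun ε => periodicExtend (U ε).1, periodicExtend u'.1, ⟨?_, ?_, ?_⟩, fun t => ?_⟩
    · simp only [hU0]
    · exact fun t => hasDerivAt_periodicExtend_path hU t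
    · have hU𝒰 : ∀ᶠ ε in 𝓝 (0 : ℝ), U ε ∈ 𝒰 := by
        have := hU.continuousAt.tendsto
        rw [hU0] at this
        exact this.eventually (hopen.mem_nhds hu)
      obtain ⟨M, hM, hMq⟩ := hqt.exists_c1Norm_smul_le
      have hnorm : ∀ᶠ ε in 𝓝 (0 : ℝ), c1Norm (p + ε • q) < ENNReal.ofReal ε₀ := by
        have h1 : Tendsto (fun ε : ℝ => c1Norm p + ENNReal.ofReal (|ε| * M)) (𝓝 0)
            (𝓝 (c1Norm p + ENNReal.ofReal (|0| * M))) :=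
          (ENNReal.tendsto_ofReal ((continuous_abs.mul continuous_const).tendsto 0)).const_add _
        rw [abs_zero, zero_mul, ENNReal.ofReal_zero, add_zero] at h1
        filter_upwards [h1.eventually (gt_mem_nhds hpε)] with ε hε
        refine (c1Norm_add_le (hp.contDiff.differentiable (by simp))
          ((hq.smul ε).contDiff.differentiable (by simp))).trans_lt ?_
        exact (add_le_add_right (hMq ε) _).trans_lt hε
      filter_upwards [hev, hU𝒰, hnorm] with ε h1 h2 h3
      refine ⟨p + ε • q, h + ε • q', U ε, hp.add (hq.smul ε), h3, ?_, by rw [add_assoc], rfl, h2,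
        by rw [h1.1, hzero], h1.2⟩
      rw [ContinuousMap.coe_add, hh, add_assoc]
      rfl
    · refine (norm_periodicExtend_le _ _).trans ((norm_fst_le u').trans (hu'.trans_eq ?_))
      congr 1
      refine intervalIntegral.integral_congr fun r hr => ?_
      rw [uIcc_of_le zero_le_one] at hr
      have h01 := (hasDerivAt_periodicExtend (congrArg Prod.fst hzero)).1
      simp only [periodicExtend_eqOn u.1 h01 hr]
      rfl

end NodeSpaces

end Network

end

/-! ### Application to the given orbit -/

theorem corollary11p2 {C A : Type*} [Fintype C] [DecidableEq C] [Fintype A]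
    (G : Network C A) (S : G.NodeSpaces)
    (f : S.State → S.State) (hf : S.IsAdmissible f)
    (x : ℝ → S.State) (T : ℝ) (hx : S.IsStronglyHyperbolic f x T)
    (c d : C) (θ : ℝ) (hcd : S.LocallyRigidPhaseShift f x T c d θ) :
    G.InputEquivalent c d := by
  obtain ⟨a, b, t₀, ht₀, ℓ, hℓ, η, hη, ε₀, hε₀, hrigid⟩ := hcd
  have hhyp := hx.1
  have horb := hhyp.1
  have hc : Continuous x := continuous_iff_continuousAt.2 fun t => (horb.solution t).continuousAt
  have hT := horb.period_pos
  let f' : C(S.State, S.State) := ⟨f, hf.contDiff.continuous⟩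
  have hf' : ContDiff ℝ 1 f' := hf.contDiff.of_le (by exact_mod_cast le_top)
  obtain ⟨𝒰, h𝒰, hopen, hu₀⟩ := eventually_nhds_iff.1
    (eventually_isPerturbedOrbit ℓ horb hc t₀ hη)
  have hG := Network.NodeSpaces.isResponsive_isNearbyOrbit hf ε₀ ℓ (ℓ (x t₀)) hopen
    fun u hu => (h𝒰 u hu).1
  have hzero : S.IsAdmissible 0 := by
    have := hf.smul 0
    rwa [zero_smul] at this
  have hgood : Network.NodeSpaces.IsNearbyOrbit f ε₀ ℓ (ℓ (x t₀)) 𝒰 f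
      (periodicExtend (orbitPath x hc t₀ T)) :=
    ⟨0, f', (orbitPath x hc t₀ T, T), hzero, by simpa [c1Norm] using hε₀, (add_zero f).symm,
      (add_zero f).symm, rfl, hu₀, orbitMap_orbitPath ℓ (g := f') horb hc,
      IsHyperbolicPeriodicOrbit.isInvertible_fderiv_orbitMap hf' hhyp hc hℓ⟩
  -- In rescaled time the delay `θ * T'` becomes `θ` for every member of the family. Periods in `𝒰`
  -- are below `2 * T`, so `|s| < ρ` keeps `t₀ + s * u.2` inside `(a, b)`.
  refine hG.inputEquivalent hgood (θ := θ) (ρ := min (t₀ - a) (b - t₀) / (2 * T))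
    (div_pos (lt_min (by linarith [ht₀.1]) (by linarith [ht₀.2])) (by linarith)) ?_
  rintro g z ⟨p, h, u, hp, hpε, hh, rfl, rfl, hu, huz, -⟩ s hs
  obtain ⟨hpos, hlt, hpert⟩ := h𝒰 u hu
  have hper := hpert h (congrArg Prod.fst huz)
  rw [hh] at hper
  have hsec : ℓ (orbitOf t₀ u t₀) = ℓ (x t₀) := by
    have h1 : ℓ (u.1 0) = ℓ (x t₀) := congrArg Prod.snd huz
    have h2 := pathExtend_coe u.1 0
    rw [← h1, ← h2]
    simp [orbitOf, periodicExtend]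
  have hsτ : |s * u.2| < min (t₀ - a) (b - t₀) := by
    have h1 : |s| * (2 * T) < min (t₀ - a) (b - t₀) := by
      rw [← lt_div_iff₀ (by linarith)]
      exact abs_lt.2 hs
    rw [abs_mul, abs_of_pos hpos]
    exact (mul_le_mul_of_nonneg_left hlt.le (abs_nonneg s)).trans_lt h1
  obtain ⟨h1, h2⟩ := lt_min_iff.1 hsτ
  have h3 := hrigid p hp hpε _ _ hper hsec (t₀ + s * u.2)
    ⟨by linarith [(abs_lt.1 h1).1], by linarith [(abs_lt.1 h2).2]⟩
  rwa [add_assoc, ← add_mul, orbitOf_add_mul hpos.ne', orbitOf_add_mul hpos.ne'] at h3
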